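/- Let $d\in\mathbb N$, $T>0$, $\alpha\in(\tfrac12,1)$, $\gamma\in(0,1]$, and let $W$ be a standard $d$-dimensional Brownian motion on a filtered probability space $(\Omega,\mathcal F,\mathbb P,(\mathcal F_t)_{t\in[0,T]})$ satisfying the usual conditions. Put $H=L^2(0,T;\mathbb R^d)$ with norm $\|\cdot\|_2$, $H_\otimes=L^2((0,T)\times(0,T);\mathbb R^d)$ with norm $\|\cdot\|_{2,\otimes}$, $\Lambda=C([0,T];\mathbb R^d)$, $\Lambda_2=(\Lambda,\|\cdot\|_2)$, and $\mathcal H=L^2(\Omega;H)$. Let $\sigma(t)\colon\mathbb R^d\to H$ be given by $[\sigma(t)x](\xi)=\Gamma(\alpha)^{-1}(\xi-t)^{\alpha-1}1_{\{t<\xi\}}x$. Let $B\colon\Lambda\to H_\otimes$ and $C_0>0$ satisfy the following, for all $w_1,w_2,w\in\Lambda$: (i) $\|B(w)\|_{2,\otimes}\le C_0(1+\|w\|_2)$ and $\|B(w_1)-B(w_2)\|_{2,\otimes}\le C_0\|w_1-w_2\|_2$; (ii) for every $t\in(0,T]$ and a.e. $r\in(0,t)$, $B(w)(r,\xi)=0$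 for a.e. $\xi\in(0,r)$, and $B(w)(r,\cdot)$ depends on $w$ only via $w|_{(0,t)}$; (iii) $B$ is Fréchet differentiable on $\Lambda_2$, with $\|DB(w_1)w_2\|_{2,\otimes}\le C_0\|w_2\|_2$ and $\|DB(w_1)-DB(w_2)\|_{\mathcal L(\Lambda_2;H_\otimes)}\le C_0\|w_1-w_2\|_2^{\gamma}$. Let $\bar B\colon H\to H_\otimes$ be the continuous extension of $B$. Then $\bar B$ is Fréchet differentiable on $H$. For $0\le s\le t\le T$ and $\phi\in H$ there is a unique $w=w^{s,\phi}_t\in\mathcal H$ such that, $\mathbb P$-a.s., $$w=\phi+\int_s^t\bar B(w)(r,\cdot)\,dr+\int_s^t\sigma(r)\,dW_r .$$ For every $0\le s\le t\le T$ the map $\phi\mapsto w^{s,\phi}_t$ from $H$ to $\mathcal H$ is of class $C^{1+\gamma}$, that is, continuously Fréchet differentiable with globally $\gamma$-Hölder continuous derivative $H\to\mathcal L(H;\mathcal H)$. For every $\phi,\psi\in H$, its derivative $Dw^{s,\phi}_t\psi$ is the unique $v\in\mathcal H$ such that, $\mathbb P$-a.s., $$v=\psi+\int_s^t \big[D\bar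 B(w^{s,\phi}_t)\,v\big](r,\cdot)\,dr .$$ Furthermore, there is a constant $C_2>0$, depending only on $d$, $T$ and $C_0$, such that for all $0\le s\le t\le T$ and all $\phi,\psi,\eta\in H$, $\mathbb P$-a.s., $$\|Dw^{s,\phi}_t\eta\|_2\le C_2\|\eta\|_2,\qquad \|Dw^{s,\phi}_t\eta-Dw^{s,\psi}_t\eta\|_2\le C_2\,\|w^{s,\phi}_t-w^{s,\psi}_t\|_2^{\gamma}\,\|\eta\|_2 .$$ -/

import Mathlib

open MeasureTheory ProbabilityTheory Set Filter Topology
open scoped NNReal ENNReal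

noncomputable section

namespace VolterraFlow

/-- `ℝᵈ` with its Euclidean norm. -/
abbrev E (d : ℕ) : Type := EuclideanSpace ℝ (Fin d)

/-- Lebesgue measure on `[0,T]`. -/
instance (T : ℝ) : MeasureSpace (Icc (0 : ℝ) T) := Measure.Subtype.measureSpace

instance (T : ℝ) : IsFiniteMeasure (volume : Measure (Icc (0 : ℝ) T)) := by
  refine ⟨?_⟩
  rw [Measure.Subtype.volume_univ measurableSet_Icc.nullMeasurableSet]
  exact measure_Icc_lt_top

/-- `H = L²(0,T;ℝᵈ)`; the interval `[0,T]` carries Lebesgue measure. -/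
abbrev H (T : ℝ) (d : ℕ) : Type := Lp (E d) 2 (volume : Measure (Icc (0 : ℝ) T))

/-- `H_⊗ = L²((0,T)×(0,T);ℝᵈ)`. -/
abbrev Hts (T : ℝ) (d : ℕ) : Type :=
  Lp (E d) 2 (volume : Measure (Icc (0 : ℝ) T × Icc (0 : ℝ) T))

/-- `Λ₂`: the space `Λ = C([0,T];ℝᵈ)`, with the `L²(0,T;ℝᵈ)`-norm instead of the sup norm. -/
def Lam2 (T : ℝ) (d : ℕ) : Type := C(Icc (0 : ℝ) T, E d)

instance (T : ℝ) (d : ℕ) : AddCommGroup (Lam2 T d) :=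
  inferInstanceAs (AddCommGroup C(Icc (0 : ℝ) T, E d))

instance (T : ℝ) (d : ℕ) : Module ℝ (Lam2 T d) :=
  inferInstanceAs (Module ℝ C(Icc (0 : ℝ) T, E d))

instance (T : ℝ) (d : ℕ) : CoeFun (Lam2 T d) (fun _ => Icc (0 : ℝ) T → E d) :=
  ⟨fun w => ContinuousMap.toFun w⟩

/-- The inclusion of `Λ` in `H`. -/
def toH (T : ℝ) (d : ℕ) : Lam2 T d →ₗ[ℝ] H T d :=
  (ContinuousMap.toLp (E := E d) 2 (volume : Measure (Icc (0 : ℝ) T)) ℝ).toLinearMap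

instance (T : ℝ) (d : ℕ) : SeminormedAddCommGroup (Lam2 T d) :=
  SeminormedAddCommGroup.induced (Lam2 T d) (H T d) (toH T d)

instance (T : ℝ) (d : ℕ) : NormedSpace ℝ (Lam2 T d) :=
  NormedSpace.induced ℝ (Lam2 T d) (H T d) (toH T d)

theorem norm_Lam2 (T : ℝ) (d : ℕ) (w : Lam2 T d) : ‖w‖ = ‖toH T d w‖ := rfl

/-- For `T > 0` the seminorm of `Λ₂` is a norm. -/
theorem toH_injective {T : ℝ} (hT : 0 < T) (d : ℕ) : Function.Injective (toH T d) := by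
  have : (volume : Measure (Icc (0 : ℝ) T)).IsOpenPosMeasure := by
    refine ⟨fun U hU ⟨x, hx⟩ h0 => ?_⟩
    obtain ⟨V, hV, rfl⟩ := isOpen_induced_iff.1 hU
    have hcl : (x : ℝ) ∈ closure (Ioo (0 : ℝ) T) := by
      rw [closure_Ioo hT.ne]; exact x.2
    obtain ⟨y, hyV, hy⟩ := mem_closure_iff.1 hcl V hV hx
    have hpos : 0 < volume (V ∩ Ioo (0 : ℝ) T) :=
      (hV.inter isOpen_Ioo).measure_pos volume ⟨y, hyV, hy⟩
    have hle : volume (V ∩ Ioo (0 : ℝ) T) ≤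
        volume ((Subtype.val : Icc (0 : ℝ) T → ℝ) ⁻¹' V) := by
      have himg := MeasurableEmbedding.comap_apply
        (MeasurableEmbedding.subtype_coe (measurableSet_Icc (a := (0 : ℝ)) (b := T)))
        volume ((Subtype.val : Icc (0 : ℝ) T → ℝ) ⁻¹' V)
      have : volume ((Subtype.val : Icc (0 : ℝ) T → ℝ) ⁻¹' V) =
          volume (Subtype.val '' ((Subtype.val : Icc (0 : ℝ) T → ℝ) ⁻¹' V)) := himg
      rw [this, Subtype.image_preimage_coe]
      exact measure_mono fun z hz => ⟨⟨hz.2.1.le, hz.2.2.le⟩, hz.1⟩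
    exact absurd (hpos.trans_le hle) (by simp [h0])
  exact ContinuousMap.toLp_injective (E := E d) (p := 2) (𝕜 := ℝ) volume

theorem isDenseInducing_toH (T : ℝ) (d : ℕ) : IsDenseInducing (toH T d) where
  toIsInducing := ⟨rfl⟩
  dense := ContinuousMap.toLp_denseRange (E d) (volume : Measure (Icc (0 : ℝ) T)) ℝ
    (p := 2) (by norm_num)

variable {T : ℝ} {d : ℕ}

/-- The extension `B̄ : H → H_⊗` of `B : Λ → H_⊗` by continuity. -/
def Bbar (B : Lam2 T d → Hts T d) : H T d → Hts T d :=
  (isDenseInducing_toH T d).extend B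

/-- The section `F(r,·) ∈ H` of `F ∈ H_⊗`; it is square integrable for a.e. `r`. -/
def slice (F : Hts T d) (r : Icc (0 : ℝ) T) : H T d :=
  open Classical in
  if h : MemLp (fun ξ => F (r, ξ)) 2 volume then h.toLp _ else 0

/-- The Bochner integral `∫ₛᵗ F(r,·) dr` in `H`, for `F ∈ H_⊗`. -/
def intSlice (s t : Icc (0 : ℝ) T) (F : Hts T d) : H T d := ∫ r in Ioc s t, slice F r

/-- The standing conditions on the drift: linear growth, Lipschitz continuity, Volterra type, and
dependence of `B(w)(r,·)`, `r < t`, on `w|_(0,t)` only. -/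
structure DriftLipschitz (C₀ : ℝ) (B : Lam2 T d → Hts T d) : Prop where
  growth : ∀ w, ‖B w‖ ≤ C₀ * (1 + ‖w‖)
  lipschitz : ∀ w₁ w₂, ‖B w₁ - B w₂‖ ≤ C₀ * ‖w₁ - w₂‖
  volterra : ∀ w, ∀ t : Icc (0 : ℝ) T, 0 < (t : ℝ) →
    ∀ᵐ r : Icc (0 : ℝ) T, r < t → ∀ᵐ ξ : Icc (0 : ℝ) T, ξ < r → B w (r, ξ) = 0
  nonanticipative : ∀ w₁ w₂, ∀ t : Icc (0 : ℝ) T, 0 < (t : ℝ) →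
    (∀ r : Icc (0 : ℝ) T, 0 < (r : ℝ) → r < t → w₁ r = w₂ r) →
    ∀ᵐ r : Icc (0 : ℝ) T, r < t → ∀ᵐ ξ : Icc (0 : ℝ) T, B w₁ (r, ξ) = B w₂ (r, ξ)

/-- In addition, `B` is Fréchet differentiable on `Λ₂`, with bounded, `γ`-Hölder derivative. -/
structure DriftC1 (C₀ γ : ℝ) (B : Lam2 T d → Hts T d) : Prop extends DriftLipschitz C₀ B where
  differentiable : Differentiable ℝ B
  bound : ∀ w₁ w₂, ‖fderiv ℝ B w₁ w₂‖ ≤ C₀ * ‖w₂‖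
  holder : ∀ w₁ w₂, ‖fderiv ℝ B w₁ - fderiv ℝ B w₂‖ ≤ C₀ * ‖w₁ - w₂‖ ^ γ

/-- The fractional kernel `k₂(u) = u^(α-1) / Γ(α)`, `u > 0`. -/
def k₂ (α u : ℝ) : ℝ := u ^ (α - 1) / Real.Gamma α

/-- `ξ ↦ k₂(ξ-t) 1_{t<ξ} x`. -/
def kernelFun (α : ℝ) (t : Icc (0 : ℝ) T) (x : E d) (ξ : Icc (0 : ℝ) T) : E d :=
  open Classical in
  if t < ξ then k₂ α ((ξ : ℝ) - t) • x else 0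

theorem memLp_kernelFun {α : ℝ} (hα : 1 / 2 < α) (t : Icc (0 : ℝ) T) (x : E d) :
    MemLp (kernelFun α t x) 2 volume := by
  have hT : (0 : ℝ) ≤ T := t.2.1.trans t.2.2
  have hint : IntegrableOn (fun u : ℝ => u ^ (2 * (α - 1))) (Ioc 0 T) volume := by
    have := intervalIntegral.intervalIntegrable_rpow' (a := 0) (b := T) (r := 2 * (α - 1))
      (by linarith)
    rwa [intervalIntegrable_iff_integrableOn_Ioc_of_le hT] at this
  have hK : MemLp (fun u : ℝ => (Ioc (0 : ℝ) T).indicator (fun u => k₂ α u) u) 2 volume := by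
    have hm : Measurable (fun u : ℝ => (Ioc (0 : ℝ) T).indicator (fun u => k₂ α u) u) := by
      refine Measurable.indicator ?_ measurableSet_Ioc
      unfold k₂
      fun_prop
    rw [memLp_two_iff_integrable_sq hm.aestronglyMeasurable]
    have h2 : IntegrableOn (fun u : ℝ => u ^ (2 * (α - 1)) / Real.Gamma α ^ 2) (Ioc 0 T) :=
      hint.div_const _
    refine ((integrable_indicator_iff measurableSet_Ioc).2 h2).congr
      (Eventually.of_forall fun u => ?_)
    by_cases hu : u ∈ Ioc (0 : ℝ) T
    · simp only [hu, indicator_of_mem, k₂, div_pow]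
      congr 1
      rw [mul_comm, Real.rpow_mul hu.1.le]
      norm_num
    · simp [hu]
  have hshift : MemLp (fun u : ℝ => (Ioc (0 : ℝ) T).indicator (fun u => k₂ α u) (u - t)) 2
      volume := hK.comp_measurePreserving (measurePreserving_sub_right volume (t : ℝ))
  have hres := (hshift.restrict (Icc (0 : ℝ) T)).comp_measurePreserving
    (measurePreserving_subtype_coe (measurableSet_Icc (a := (0 : ℝ)) (b := T)))
  refine ((ContinuousLinearMap.toSpanSingleton ℝ x).comp_memLp' hres).ae_eq (Eventually.of_forall fun ξ => ?_)
  have hξ : (ξ : ℝ) - t ≤ T := by linarith [ξ.2.2, t.2.1]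
  by_cases h : t < ξ
  · have h' : (t : ℝ) < ξ := h
    have hm : (ξ : ℝ) - t ∈ Ioc (0 : ℝ) T := ⟨by linarith, hξ⟩
    simp only [kernelFun, h, if_true, Function.comp, ContinuousLinearMap.toSpanSingleton_apply]
    rw [indicator_of_mem hm]
  · have h' : ¬ (t : ℝ) < ξ := h
    have hm : (ξ : ℝ) - t ∉ Ioc (0 : ℝ) T := fun hh => h' (by linarith [hh.1])
    simp only [kernelFun, h, if_false, Function.comp, ContinuousLinearMap.toSpanSingleton_apply]
    rw [indicator_of_notMem hm, zero_smul]

/-- `σ(t) : ℝᵈ → H`, `[σ(t)x](ξ) = k₂(ξ-t) 1_{t<ξ} x`. -/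
def sigma {α : ℝ} (hα : 1 / 2 < α) (t : Icc (0 : ℝ) T) : E d →L[ℝ] H T d :=
  LinearMap.toContinuousLinearMap
    { toFun := fun x => (memLp_kernelFun hα t x).toLp (kernelFun α t x)
      map_add' := fun x y => by
        rw [← MemLp.toLp_add]
        congr 1
        funext ξ
        simp only [kernelFun, Pi.add_apply]
        split_ifs <;> simp
      map_smul' := fun c x => by
        rw [RingHom.id_apply, ← MemLp.toLp_const_smul]
        congr 1
        funext ξ
        simp only [kernelFun, Pi.smul_apply]
        split_ifs
        · rw [smul_comm]
        · simp }

section Probability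

variable {Ω : Type*} [mΩ : MeasurableSpace Ω]

/-- The usual conditions for a filtration indexed by `[0,T]`. They imply that the probability
space is complete. -/
structure UsualConditions (𝓕 : Filtration (Icc (0 : ℝ) T) mΩ) (P : Measure Ω) : Prop where
  rightContinuous : 𝓕.IsRightContinuous
  complete : ∀ t, ∀ A : Set Ω, P A = 0 → MeasurableSet[𝓕 t] A

/-- `W` is a standard `d`-dimensional Brownian motion on `[0,T]` with respect to `𝓕`. -/
structure IsBrownianMotion (𝓕 : Filtration (Icc (0 : ℝ) T) mΩ) (P : Measure Ω)
    (W : Icc (0 : ℝ) T → Ω → E d) : Prop where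
  adapted : ∀ t, Measurable[𝓕 t] (W t)
  start : ∀ t : Icc (0 : ℝ) T, (t : ℝ) = 0 → ∀ᵐ ω ∂P, W t ω = 0
  continuous : ∀ᵐ ω ∂P, Continuous fun t => W t ω
  law : ∀ s t, s ≤ t → P.map (fun ω => W t ω - W s ω) =
    (stdGaussian (E d)).map (fun x => Real.sqrt ((t : ℝ) - s) • x)
  indep : ∀ s t, s ≤ t →
    Indep (MeasurableSpace.comap (fun ω => W t ω - W s ω) inferInstance) (𝓕 s) P

/-- A step function on `(s,t]` with values in the operators `ℝᵈ → H`: it equals `Φ i` on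
`(τ i, τ (i+1)]`, `i < m`. -/
structure StepIntegrand (d : ℕ) (s t : Icc (0 : ℝ) T) where
  m : ℕ
  τ : ℕ → Icc (0 : ℝ) T
  mono : Monotone τ
  first : τ 0 = s
  last : τ m = t
  Φ : ℕ → E d →L[ℝ] H T d

/-- The value of the step function at the time `r`. -/
def StepIntegrand.val {s t : Icc (0 : ℝ) T} (f : StepIntegrand d s t) (r : Icc (0 : ℝ) T) :
    E d →L[ℝ] H T d :=
  ∑ i ∈ Finset.range f.m, (Ioc (f.τ i) (f.τ (i + 1))).indicator (fun _ => f.Φ i) r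

/-- The elementary stochastic integral of the step function. -/
def StepIntegrand.integral {s t : Icc (0 : ℝ) T} (f : StepIntegrand d s t)
    (W : Icc (0 : ℝ) T → Ω → E d) (ω : Ω) : H T d :=
  ∑ i ∈ Finset.range f.m, f.Φ i (W (f.τ (i + 1)) ω - W (f.τ i) ω)

/-- The square of the Hilbert-Schmidt norm of an operator `ℝᵈ → H`. -/
def hsNormSq (A : E d →L[ℝ] H T d) : ℝ≥0∞ :=
  ∑ j : Fin d, ‖A (EuclideanSpace.single j 1)‖ₑ ^ 2

/-- `I = ∫ₛᵗ f(r) dW_r` for a deterministic integrand `f`: `I` is the limit in `L²(Ω;H)` of the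
elementary integrals of step functions that converge to `f` in `L²(s,t)` for the
Hilbert-Schmidt norm. -/
def IsStochIntegral (P : Measure Ω) (W : Icc (0 : ℝ) T → Ω → E d)
    (f : Icc (0 : ℝ) T → E d →L[ℝ] H T d) (s t : Icc (0 : ℝ) T) (I : Lp (H T d) 2 P) : Prop :=
  ∃ g : ℕ → StepIntegrand d s t,
    Tendsto (fun n => ∫⁻ r in Ioc s t, hsNormSq ((g n).val r - f r)) atTop (𝓝 0) ∧
    Tendsto (fun n => eLpNorm (fun ω => (g n).integral W ω - I ω) 2 P) atTop (𝓝 0)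

/-- The stochastic integral `∫ₛᵗ f(r) dW_r ∈ L²(Ω;H)`. For a Brownian motion `W` and
`f ∈ L²(s,t)` it exists and is unique, by Itô's isometry. -/
def stochIntegral (P : Measure Ω) (W : Icc (0 : ℝ) T → Ω → E d)
    (f : Icc (0 : ℝ) T → E d →L[ℝ] H T d) (s t : Icc (0 : ℝ) T) : Lp (H T d) 2 P :=
  open Classical in
  if h : ∃ I, IsStochIntegral P W f s t I then h.choose else 0

/-- `w ∈ L²(Ω;H)` solves `w = φ + ∫ₛᵗ B̄(w)(r,·) dr + ∫ₛᵗ σ(r) dW_r`, almost surely. -/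
def IsSolution (P : Measure Ω) (W : Icc (0 : ℝ) T → Ω → E d) {α : ℝ} (hα : 1 / 2 < α)
    (B : Lam2 T d → Hts T d) (s t : Icc (0 : ℝ) T) (φ : H T d) (w : Lp (H T d) 2 P) : Prop :=
  ∀ᵐ ω ∂P, w ω = φ + intSlice s t (Bbar B (w ω)) + stochIntegral P W (sigma hα) s t ω

/-- `v ∈ L²(Ω;H)` solves `v = ψ + ∫ₛᵗ [DB̄(w) v](r,·) dr`, almost surely. -/
def IsLinearizedSolution (P : Measure Ω) (B : Lam2 T d → Hts T d) (s t : Icc (0 : ℝ) T)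
    (w : Lp (H T d) 2 P) (ψ : H T d) (v : Lp (H T d) 2 P) : Prop :=
  ∀ᵐ ω ∂P, v ω = ψ + intSlice s t (fderiv ℝ (Bbar B) (w ω) (v ω))

end Probability

/-- `f` is of class `C^{1+γ}`: continuously differentiable with (globally) `γ`-Hölder derivative. -/
def IsC1Holder {X Y : Type*} [NormedAddCommGroup X] [NormedSpace ℝ X] [NormedAddCommGroup Y]
    [NormedSpace ℝ Y] (γ : ℝ) (f : X → Y) : Prop :=
  ContDiff ℝ 1 f ∧ ∃ C : ℝ, ∀ x y, ‖fderiv ℝ f x - fderiv ℝ f y‖ ≤ C * ‖x - y‖ ^ γ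

end VolterraFlow

end

/-! The noise is additive: `∫ₛᵗ σ dW` is a fixed element `I` of `L²(Ω;H)`, depending neither on `φ`
nor on `w`. Hence the equation decouples in `ω`. With `G x = ∫ₛᵗ B̄(x)(r,·) dr` it reads `x = y + G
x` at `y = φ + I(ω)`, and everything reduces to the deterministic solution map `S = (id - G)⁻¹` on
`H`.

`G` contracts by `1/2` in the norm `‖exp(-cξ) x‖₂`, `c = 2C₀²`, which is equivalent to the `L²` norm
(`DriftLipschitz.norm_expMul_intSlice_sub_le`). Two facts combine. The Volterra property makes `F ↦
∫ F(r,·) dr` of size `(2c)^(-1/2)` between weighted spaces. Causality turns the global Lipschitz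
bound of `B` into one on each initial interval, and integrating these bounds against a decreasing
weight gives a weighted Lipschitz bound.

The derivative of `G` inherits the contraction, so `id - DG(x)` is invertible with inverse bounded
by `2K`, `K = exp(cT)`. Its inverse at `x = S y` is the derivative `L y` of `S`, and the resolvent
identity carries the Hölder bound of `DB̄` over to `L` (`exists_solutionMap`).

The solution is `w = S(φ + I)`. The increments of `φ` are deterministic, so the Taylor remainder of
`S` is bounded uniformly in `ω`, and differentiability passes to `L²(Ω;H)`
(`hasFDerivAt_randomShift`). -/

namespace VolterraFlow

/-! ### Differentiability of continuous extensions from a dense subspace. -/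

section Extension

variable {X Y Z : Type*} [NormedAddCommGroup X] [NormedSpace ℝ X] [NormedAddCommGroup Y]
  [NormedSpace ℝ Y] [NormedAddCommGroup Z] [NormedSpace ℝ Z]

/-- First order Taylor estimate for a map with `γ`-Hölder derivative. -/
theorem norm_taylor_le_of_holder {C γ : ℝ} (hC : 0 ≤ C) (hγ : 0 < γ) {f : X → Z}
    {D : X → X →L[ℝ] Z} (hf : ∀ x, HasFDerivAt f (D x) x)
    (hD : ∀ x y, ‖D x - D y‖ ≤ C * ‖x - y‖ ^ γ) (x h : X) :
    ‖f (x + h) - f x - D x h‖ ≤ C * ‖h‖ ^ γ * ‖h‖ := by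
  have key := (convex_segment x (x + h)).norm_image_sub_le_of_norm_hasFDerivWithin_le'
    (f := f) (f' := D) (φ := D x) (C := C * ‖h‖ ^ γ) (x := x) (y := x + h)
    (fun y _ => (hf y).hasFDerivWithinAt) ?_ (left_mem_segment ℝ x (x + h))
    (right_mem_segment ℝ x (x + h))
  · simpa using key
  · intro y hy
    refine (hD y x).trans ?_
    have : ‖y - x‖ ≤ ‖h‖ := by
      simpa using norm_sub_le_of_mem_segment hy
    gcongr

/-- A map with a first order Taylor estimate of order `1 + γ` is differentiable. -/
theorem hasFDerivAt_of_taylor_le {C γ : ℝ} (hγ : 0 < γ) {f : X → Z} {D : X →L[ℝ] Z} {x : X}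
    (h : ∀ u, ‖f (x + u) - f x - D u‖ ≤ C * ‖u‖ ^ γ * ‖u‖) : HasFDerivAt f D x := by
  rw [hasFDerivAt_iff_isLittleO_nhds_zero]
  have h1 : (fun u : X => f (x + u) - f x - D u) =O[𝓝 0] fun u => ‖u‖ ^ γ * ‖u‖ := by
    refine Asymptotics.IsBigO.of_bound C (Eventually.of_forall fun u => ?_)
    rw [Real.norm_of_nonneg (by positivity), ← mul_assoc]
    exact h u
  refine h1.trans_isLittleO ?_
  have h2 : (fun u : X => ‖u‖ ^ γ) =o[𝓝 0] fun _ => (1 : ℝ) := by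
    rw [Asymptotics.isLittleO_one_iff]
    have : Tendsto (fun u : X => ‖u‖ ^ γ) (𝓝 0) (𝓝 (‖(0 : X)‖ ^ γ)) :=
      (continuous_norm.rpow_const fun _ => Or.inr hγ.le).tendsto 0
    simpa [Real.zero_rpow hγ.ne'] using this
  have h3 := h2.mul_isBigO (Asymptotics.isBigO_refl (fun u : X => ‖u‖) (𝓝 0))
  simp only [one_mul] at h3
  exact h3.of_norm_right

theorem uniformContinuous_of_holder {X Z : Type*} [SeminormedAddCommGroup X]
    [SeminormedAddCommGroup Z] {C γ : ℝ} (hγ : 0 < γ) {f : X → Z}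
    (hf : ∀ x y, ‖f x - f y‖ ≤ C * ‖x - y‖ ^ γ) : UniformContinuous f := by
  have hc : Tendsto (fun r : ℝ => C * r ^ γ) (𝓝 0) (𝓝 0) := by
    have : Tendsto (fun r : ℝ => C * r ^ γ) (𝓝 0) (𝓝 (C * 0 ^ γ)) :=
      (continuous_const.mul (continuous_id.rpow_const fun _ => Or.inr hγ.le)).tendsto 0
    simpa [Real.zero_rpow hγ.ne'] using this
  rw [Metric.uniformContinuous_iff]
  intro ε hε
  obtain ⟨δ, hδ, h⟩ := Metric.tendsto_nhds_nhds.1 hc ε hε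
  refine ⟨δ, hδ, fun x y hxy => ?_⟩
  rw [dist_eq_norm] at hxy ⊢
  refine (hf x y).trans_lt ((le_abs_self _).trans_lt ?_)
  have := h (x := ‖x - y‖) (by simpa using hxy)
  simpa using this

/-- The extension by continuity of a map with bounded Hölder derivative on a dense subspace is
again differentiable with Hölder derivative. -/
theorem exists_hasFDerivAt_extend [CompleteSpace Z] {C γ : ℝ} (hC : 0 ≤ C) (hγ : 0 < γ)
    (e : X →ₗᵢ[ℝ] Y) (he : IsDenseInducing e) {f : X → Z} {D : X → X →L[ℝ] Z}
    (hf : ∀ x, HasFDerivAt f (D x) x) (hfe : Continuous (he.extend f))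
    (hD : ∀ x y, ‖D x - D y‖ ≤ C * ‖x - y‖ ^ γ) :
    ∃ D' : Y → Y →L[ℝ] Z, (∀ y, HasFDerivAt (he.extend f) (D' y) y) ∧
      ∀ x y, ‖D' x - D' y‖ ≤ C * ‖x - y‖ ^ γ := by
  have hfc : Continuous f := continuous_iff_continuousAt.2 fun x => (hf x).continuousAt
  have hui : IsUniformInducing e := e.isometry.isUniformInducing
  -- The derivative is extended twice by density: here in the direction, below (`he.extend De`) in
  -- the base point.
  let De : X → Y →L[ℝ] Z := fun x => (D x).extend e.toContinuousLinearMap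
  have hDe : ∀ x u, De x (e u) = D x u := fun x u =>
    ContinuousLinearMap.extend_eq (D x) (e := e.toContinuousLinearMap) he.dense hui u
  have hDe' : ∀ x y, ‖De x - De y‖ ≤ C * ‖x - y‖ ^ γ := by
    intro x y
    refine ContinuousLinearMap.opNorm_le_bound _ (by positivity) fun u => ?_
    refine he.dense.induction_on (p := fun u => ‖(De x - De y) u‖ ≤ C * ‖x - y‖ ^ γ * ‖u‖) u
      (isClosed_le (by fun_prop) (by fun_prop)) fun a => ?_
    have : (De x - De y) (e a) = (D x - D y) a := by simp [hDe]
    rw [this, e.norm_map]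
    exact ((D x - D y).le_opNorm a).trans (by gcongr; exact hD x y)
  have hDu : UniformContinuous De := uniformContinuous_of_holder hγ hDe'
  have hD'c : Continuous (he.extend De) := by
    have := uniformContinuous_uniformly_extend hui he.dense hDu
    exact this.continuous
  have hext : ∀ x, he.extend De (e x) = De x := fun x => he.extend_eq hDu.continuous x
  have hfx : ∀ x, he.extend f (e x) = f x := fun x => he.extend_eq hfc x
  have hpow : Continuous fun r : ℝ => r ^ γ :=
    continuous_id.rpow_const fun _ => Or.inr hγ.le
  -- Differentiability is not a closed condition, but the Taylor estimate with a fixed constant is,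
  -- so it passes from the dense subspace to `Y`.
  refine ⟨he.extend De, fun y => hasFDerivAt_of_taylor_le (C := C) hγ fun u => ?_, fun x y => ?_⟩
  · refine isClosed_property2 he.dense (p := fun y u => ‖he.extend f (y + u) - he.extend f y -
      he.extend De y u‖ ≤ C * ‖u‖ ^ γ * ‖u‖) (isClosed_le ?_ ?_) (fun a b => ?_) y u
    · have : Continuous fun q : Y × Y => he.extend De q.1 q.2 :=
        (hD'c.comp continuous_fst).clm_apply continuous_snd
      fun_prop
    · have : Continuous fun q : Y × Y => ‖q.2‖ ^ γ := hpow.comp (by fun_prop)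
      fun_prop
    · rw [← map_add, hfx, hfx, hext, hDe, e.norm_map]
      exact norm_taylor_le_of_holder hC hγ hf hD a b
  · refine isClosed_property2 he.dense (p := fun x y => ‖he.extend De x - he.extend De y‖ ≤
      C * ‖x - y‖ ^ γ) (isClosed_le ?_ ?_) (fun a b => ?_) x y
    · fun_prop
    · have : Continuous fun q : Y × Y => ‖q.1 - q.2‖ ^ γ := hpow.comp (by fun_prop)
      fun_prop
    · rw [hext, hext, ← map_sub, e.norm_map]
      exact hDe' a b

end Extension

/-! ### The extended drift and its derivative. -/

section Drift

variable {T : ℝ} {d : ℕ}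

theorem isUniformInducing_toH (T : ℝ) (d : ℕ) : IsUniformInducing (toH T d) := ⟨rfl⟩

variable {C₀ γ : ℝ} {B : Lam2 T d → Hts T d}

theorem DriftLipschitz.uniformContinuous (hB : DriftLipschitz C₀ B) : UniformContinuous B :=
  uniformContinuous_of_holder (C := C₀) one_pos fun x y => by simpa using hB.lipschitz x y

theorem DriftLipschitz.continuous_Bbar (hB : DriftLipschitz C₀ B) : Continuous (Bbar B) :=
  (uniformContinuous_uniformly_extend (isUniformInducing_toH T d) (isDenseInducing_toH T d).dense
    hB.uniformContinuous).continuous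

theorem DriftLipschitz.Bbar_toH (hB : DriftLipschitz C₀ B) (w : Lam2 T d) :
    Bbar B (toH T d w) = B w :=
  (isDenseInducing_toH T d).extend_eq hB.uniformContinuous.continuous w

theorem DriftLipschitz.norm_Bbar_sub_le (hB : DriftLipschitz C₀ B) (w₁ w₂ : H T d) :
    ‖Bbar B w₁ - Bbar B w₂‖ ≤ C₀ * ‖w₁ - w₂‖ := by
  have := hB.continuous_Bbar
  refine isClosed_property2 (isDenseInducing_toH T d).dense (p := fun w₁ w₂ =>
    ‖Bbar B w₁ - Bbar B w₂‖ ≤ C₀ * ‖w₁ - w₂‖) (isClosed_le (by fun_prop) (by fun_prop))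
    (fun a b => ?_) w₁ w₂
  rw [hB.Bbar_toH, hB.Bbar_toH, ← map_sub, ← norm_Lam2]
  exact hB.lipschitz a b

/-- The extended drift is differentiable, with Hölder derivative. -/
theorem DriftC1.exists_hasFDerivAt_Bbar (hT : 0 < T) (hC₀ : 0 ≤ C₀) (hγ : 0 < γ)
    (hB : DriftC1 C₀ γ B) :
    ∃ D : H T d → H T d →L[ℝ] Hts T d, (∀ w, HasFDerivAt (Bbar B) (D w) w) ∧
      ∀ w₁ w₂, ‖D w₁ - D w₂‖ ≤ C₀ * ‖w₁ - w₂‖ ^ γ := by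
  -- For `T > 0` the seminorm separates points. The norm structure is built on the same seminorm, so
  -- `fderiv` of `B` keeps its meaning.
  let _ : NormedAddCommGroup (Lam2 T d) :=
    { (inferInstance : SeminormedAddCommGroup (Lam2 T d)) with
      eq_of_dist_eq_zero := fun {x y} h => toH_injective hT d (eq_of_dist_eq_zero
        (show dist (toH T d x) (toH T d y) = 0 from h)) }
  let e : Lam2 T d →ₗᵢ[ℝ] H T d := ⟨toH T d, fun _ => rfl⟩
  exact exists_hasFDerivAt_extend hC₀ hγ e (isDenseInducing_toH T d)
    (fun x => (hB.differentiable x).hasFDerivAt) hB.toDriftLipschitz.continuous_Bbar hB.holder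

end Drift

end VolterraFlow

noncomputable section

namespace VolterraFlow

/-! ### Slices of `H_⊗` and the Bochner integral `∫ₛᵗ F(r,·) dr`. -/

section General

variable {X F : Type*} [MeasurableSpace X] {μ : Measure X} [NormedAddCommGroup F]

theorem enorm_sq_Lp_two (f : Lp F 2 μ) : ‖f‖ₑ ^ 2 = ∫⁻ x, ‖f x‖ₑ ^ 2 ∂μ := by
  rw [Lp.enorm_def, eLpNorm_eq_lintegral_rpow_enorm_toReal (by norm_num) (by norm_num),
    ← ENNReal.rpow_natCast, ← ENNReal.rpow_mul]
  norm_num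

/-- The Cauchy-Schwarz inequality for lower integrals. -/
theorem lintegral_mul_sq_le {f g : X → ℝ≥0∞} (hf : AEMeasurable f μ) (hg : AEMeasurable g μ) :
    (∫⁻ x, f x * g x ∂μ) ^ 2 ≤ (∫⁻ x, f x ^ 2 ∂μ) * ∫⁻ x, g x ^ 2 ∂μ := by
  have h := ENNReal.lintegral_mul_le_Lp_mul_Lq μ Real.HolderConjugate.two_two hf hg
  have h2 := pow_le_pow_left' h 2
  refine h2.trans (le_of_eq ?_)
  rw [mul_pow, ← ENNReal.rpow_natCast, ← ENNReal.rpow_natCast, ← ENNReal.rpow_mul,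
    ← ENNReal.rpow_mul]
  norm_num

/-- A map into a second countable space is measurable if all distances to points are. -/
theorem measurable_of_measurable_edist {Y : Type*} [PseudoEMetricSpace Y] [MeasurableSpace Y]
    [BorelSpace Y] [SecondCountableTopology Y] {f : X → Y}
    (hf : ∀ y, Measurable fun x => edist (f x) y) : Measurable f := by
  refine measurable_of_isOpen fun U hU => ?_
  have hball : ∀ (y : Y) (ε : ℝ≥0∞), MeasurableSet (f ⁻¹' Metric.eball y ε) := fun y ε =>
    measurableSet_lt (hf y) measurable_const
  have hchoose : ∀ y : U, ∃ ε > 0, Metric.eball (y : Y) ε ⊆ U := fun y => EMetric.isOpen_iff.1 hU y y.2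
  choose ε hε hεU using hchoose
  obtain ⟨S, hS, hSU⟩ := TopologicalSpace.isOpen_iUnion_countable
    (fun y : U => Metric.eball (y : Y) (ε y)) (fun y => Metric.isOpen_eball)
  have hU' : U = ⋃ y ∈ S, Metric.eball (y : Y) (ε y) := by
    rw [hSU]
    refine subset_antisymm (fun y hy => ?_) (iUnion_subset fun y => hεU y)
    exact mem_iUnion.2 ⟨⟨y, hy⟩, Metric.mem_eball_self (hε _)⟩
  rw [hU', preimage_iUnion₂]
  exact MeasurableSet.biUnion hS fun y _ => hball _ _

end General

variable {T : ℝ} {d : ℕ}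

instance (T : ℝ) (d : ℕ) : SecondCountableTopology (H T d) := by
  have : Fact ((2 : ℝ≥0∞) ≠ ∞) := ⟨by norm_num⟩
  infer_instance

theorem measurable_slice_lintegral (F : Hts T d) (g : Icc (0 : ℝ) T → E d)
    (hg : StronglyMeasurable g) :
    Measurable fun r => ∫⁻ ξ, ‖F (r, ξ) - g ξ‖ₑ ^ 2 := by
  have hF : StronglyMeasurable F := Lp.stronglyMeasurable F
  have : StronglyMeasurable fun z : Icc (0 : ℝ) T × Icc (0 : ℝ) T => F z - g z.2 :=
    hF.sub (hg.comp_measurable measurable_snd)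
  exact Measurable.lintegral_prod_right' (f := fun z => ‖F z - g z.2‖ₑ ^ 2)
    (this.enorm.pow_const 2)

theorem memLp_two_iff_lintegral {X G : Type*} [MeasurableSpace X] {μ : Measure X}
    [NormedAddCommGroup G] {f : X → G} (hf : AEStronglyMeasurable f μ) :
    MemLp f 2 μ ↔ ∫⁻ x, ‖f x‖ₑ ^ 2 ∂μ < ∞ := by
  rw [MemLp, eLpNorm_lt_top_iff_lintegral_rpow_enorm_lt_top (by norm_num) (by norm_num)]
  simp [hf]

theorem stronglyMeasurable_section (F : Hts T d) (r : Icc (0 : ℝ) T) :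
    StronglyMeasurable fun ξ => F (r, ξ) :=
  (Lp.stronglyMeasurable F).comp_measurable measurable_prodMk_left

theorem lintegral_lintegral_Hts (F : Hts T d) :
    ∫⁻ r, ∫⁻ ξ, ‖F (r, ξ)‖ₑ ^ 2 = ‖F‖ₑ ^ 2 := by
  rw [enorm_sq_Lp_two]
  exact (lintegral_prod (μ := volume) (ν := volume) (fun z => ‖F z‖ₑ ^ 2)
    ((Lp.stronglyMeasurable F).enorm.pow_const 2).aemeasurable).symm

theorem ae_memLp_section (F : Hts T d) :
    ∀ᵐ r : Icc (0 : ℝ) T, MemLp (fun ξ => F (r, ξ)) 2 volume := by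
  have h1 : ∫⁻ r, ∫⁻ ξ, ‖F (r, ξ)‖ₑ ^ 2 ≠ ∞ := by
    rw [lintegral_lintegral_Hts]; finiteness
  have hm : Measurable fun r => ∫⁻ ξ, ‖F (r, ξ)‖ₑ ^ 2 := by
    simpa using measurable_slice_lintegral F 0 stronglyMeasurable_zero
  filter_upwards [ae_lt_top hm h1] with r hr
  exact (memLp_two_iff_lintegral (stronglyMeasurable_section F r).aestronglyMeasurable).2 hr

theorem slice_of_memLp {F : Hts T d} {r : Icc (0 : ℝ) T}
    (h : MemLp (fun ξ => F (r, ξ)) 2 volume) : slice F r = h.toLp _ := by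
  simp [slice, h]

/-- `H` is separable, so it suffices that the distance from the slice to each fixed `g` is
measurable in `r`, which is Tonelli's theorem. -/
theorem stronglyMeasurable_slice (F : Hts T d) : StronglyMeasurable (slice F) := by
  borelize (H T d)
  refine Measurable.stronglyMeasurable ?_
  refine measurable_of_measurable_edist fun g => ?_
  have hS : MeasurableSet {r : Icc (0 : ℝ) T | MemLp (fun ξ => F (r, ξ)) 2 volume} := by
    have hm : Measurable fun r => ∫⁻ ξ, ‖F (r, ξ)‖ₑ ^ 2 := by
      simpa using measurable_slice_lintegral F 0 stronglyMeasurable_zero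
    convert measurableSet_lt hm (measurable_const (a := ∞)) using 3 with r
    exact memLp_two_iff_lintegral (stronglyMeasurable_section F r).aestronglyMeasurable
  have hm := (measurable_slice_lintegral F g (Lp.stronglyMeasurable g)).pow_const (1 / 2 : ℝ)
  classical
  -- The value `edist 0 g` reflects the default `slice F r = 0` where the section is not square
  -- integrable.
  have hite : Measurable fun r => if MemLp (fun ξ => F (r, ξ)) 2 volume then
      (∫⁻ ξ, ‖F (r, ξ) - g ξ‖ₑ ^ 2) ^ (1 / 2 : ℝ) else edist 0 g :=
    Measurable.ite hS hm measurable_const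
  convert hite using 1
  funext r
  split_ifs with h
  · have h : MemLp (fun ξ => F (r, ξ)) 2 volume := h
    rw [slice_of_memLp h, edist_eq_enorm_sub]
    have h2 := enorm_sq_Lp_two (h.toLp _ - g)
    have h3 : ∫⁻ ξ, ‖(h.toLp _ - g) ξ‖ₑ ^ 2 = ∫⁻ ξ, ‖F (r, ξ) - g ξ‖ₑ ^ 2 := by
      refine lintegral_congr_ae ?_
      filter_upwards [Lp.coeFn_sub (h.toLp _) g, h.coeFn_toLp] with ξ h4 h5
      rw [h4, Pi.sub_apply, h5]
    rw [← h3, ← h2, ← ENNReal.rpow_natCast, ← ENNReal.rpow_mul]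
    norm_num
  · have h : ¬ MemLp (fun ξ => F (r, ξ)) 2 volume := h
    simp [slice, h]

theorem integrable_slice (F : Hts T d) : Integrable (slice F) := by
  have hm : AEStronglyMeasurable (slice F) volume :=
    (stronglyMeasurable_slice F).aestronglyMeasurable
  have h2 : MemLp (slice F) 2 volume := by
    rw [memLp_two_iff_lintegral hm]
    have : ∫⁻ r, ‖slice F r‖ₑ ^ 2 = ‖F‖ₑ ^ 2 := by
      rw [← lintegral_lintegral_Hts]
      refine lintegral_congr_ae ?_
      filter_upwards [ae_memLp_section F] with r hr
      rw [slice_of_memLp hr, enorm_sq_Lp_two]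
      refine lintegral_congr_ae ?_
      filter_upwards [hr.coeFn_toLp] with ξ h5
      rw [h5]
    rw [this]
    finiteness
  exact h2.integrable (by norm_num)

theorem memLp_comp_snd (g : H T d) :
    MemLp (fun z : Icc (0 : ℝ) T × Icc (0 : ℝ) T => g z.2) 2 volume :=
  (Lp.memLp g).comp_snd _

theorem integrable_inner_snd (F : Hts T d) (g : H T d) :
    Integrable (fun z : Icc (0 : ℝ) T × Icc (0 : ℝ) T => (inner ℝ (g z.2) (F z) : ℝ)) volume := by
  refine (L2.integrable_inner ((memLp_comp_snd g).toLp _) F).congr ?_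
  filter_upwards [(memLp_comp_snd g).coeFn_toLp] with z hz
  rw [hz]

/-- Testing against `g` replaces the `H`-valued integral by a scalar double integral. Slices depend
linearly on `F` only up to null sets, so linearity and all bounds of `intSlice` are derived from
this formula. -/
theorem inner_intSlice (s t : Icc (0 : ℝ) T) (F : Hts T d) (g : H T d) :
    inner ℝ g (intSlice s t F) =
      ∫ z in Ioc s t ×ˢ univ, inner ℝ (g z.2) (F z) := by
  have hint := integrable_inner_snd F g
  rw [intSlice, ← integral_inner (integrable_slice F).integrableOn]
  refine Eq.trans ?_ (setIntegral_prod (μ := volume) (ν := volume) _ hint.integrableOn).symm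
  refine integral_congr_ae (ae_restrict_of_ae ?_)
  filter_upwards [ae_memLp_section F] with r hr
  rw [slice_of_memLp hr, L2.inner_def, Measure.restrict_univ]
  refine integral_congr_ae ?_
  filter_upwards [hr.coeFn_toLp] with ξ h5
  rw [h5]

theorem enorm_inner_intSlice_le (s t : Icc (0 : ℝ) T) (F : Hts T d) (g : H T d) :
    ‖(inner ℝ g (intSlice s t F) : ℝ)‖ₑ ≤ ∫⁻ z, ‖g z.2‖ₑ * ‖F z‖ₑ := by
  rw [inner_intSlice]
  refine (enorm_integral_le_lintegral_enorm _).trans ((setLIntegral_le_lintegral _ _).trans ?_)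
  refine lintegral_mono fun z => ?_
  simpa [enorm_eq_nnnorm, ← ENNReal.coe_mul] using nnnorm_inner_le_nnnorm (𝕜 := ℝ) (g z.2) (F z)

/-- `F ↦ ∫ₛᵗ F(r,·) dr` as a linear map. -/
def intSliceₗ (s t : Icc (0 : ℝ) T) : Hts T d →ₗ[ℝ] H T d where
  toFun := intSlice s t
  map_add' F G := by
    refine ext_inner_left ℝ fun g => ?_
    rw [inner_add_right, inner_intSlice, inner_intSlice, inner_intSlice,
      ← integral_add (integrable_inner_snd F g).integrableOn
        (integrable_inner_snd G g).integrableOn]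
    refine integral_congr_ae (ae_restrict_of_ae ?_)
    filter_upwards [Lp.coeFn_add F G] with z hz
    rw [hz, Pi.add_apply, inner_add_right]
  map_smul' c F := by
    refine ext_inner_left ℝ fun g => ?_
    rw [RingHom.id_apply, inner_smul_right, inner_intSlice, inner_intSlice,
      ← integral_const_mul]
    refine integral_congr_ae (ae_restrict_of_ae ?_)
    filter_upwards [Lp.coeFn_smul c F] with z hz
    rw [hz, Pi.smul_apply, inner_smul_right]

theorem lintegral_comp_snd (g : H T d) :
    ∫⁻ z : Icc (0 : ℝ) T × Icc (0 : ℝ) T, ‖g z.2‖ₑ ^ 2 = ENNReal.ofReal T * ‖g‖ₑ ^ 2 := by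
  have h := lintegral_prod (μ := (volume : Measure (Icc (0 : ℝ) T))) (ν := volume)
    (fun z => ‖g z.2‖ₑ ^ 2)
    (((Lp.stronglyMeasurable g).comp_measurable measurable_snd).enorm.pow_const 2).aemeasurable
  refine h.trans ?_
  have hv : (volume : Measure (Icc (0 : ℝ) T)) univ = ENNReal.ofReal T := by
    rw [Measure.Subtype.volume_univ measurableSet_Icc.nullMeasurableSet]; simp
  rw [enorm_sq_Lp_two, ← hv, mul_comm]
  exact lintegral_const (∫⁻ ξ, ‖g ξ‖ₑ ^ 2)

theorem measurable_enorm_comp_snd (g : H T d) :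
    Measurable fun z : Icc (0 : ℝ) T × Icc (0 : ℝ) T => ‖g z.2‖ₑ :=
  ((Lp.stronglyMeasurable g).comp_measurable measurable_snd).enorm

theorem measurable_enorm_Hts (F : Hts T d) : Measurable fun z => ‖F z‖ₑ :=
  (Lp.stronglyMeasurable F).enorm

theorem norm_intSlice_le (hT : 0 ≤ T) (s t : Icc (0 : ℝ) T) (F : Hts T d) :
    ‖intSlice s t F‖ ≤ √T * ‖F‖ := by
  set y := intSlice s t F
  -- Duality with the test function `g = y`, then Cauchy-Schwarz; the factor `T` comes from the free
  -- variable `r`. One factor `‖y‖ ^ 2` cancels at the end.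
  have h1 : ‖(inner ℝ y y : ℝ)‖ₑ ^ 2 ≤ (ENNReal.ofReal T * ‖y‖ₑ ^ 2) * ‖F‖ₑ ^ 2 := by
    rw [← lintegral_comp_snd, enorm_sq_Lp_two]
    exact (pow_le_pow_left' (enorm_inner_intSlice_le s t F y) 2).trans
      (lintegral_mul_sq_le (measurable_enorm_comp_snd y).aemeasurable
        (measurable_enorm_Hts F).aemeasurable)
  rw [real_inner_self_eq_norm_sq] at h1
  have h2 : (‖y‖ ^ 2) ^ 2 ≤ T * ‖y‖ ^ 2 * ‖F‖ ^ 2 := by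
    rw [← ofReal_norm, ← ofReal_norm, ← ofReal_norm, norm_pow, norm_norm,
      ← ENNReal.ofReal_pow (by positivity), ← ENNReal.ofReal_pow (by positivity),
      ← ENNReal.ofReal_pow (by positivity), ← ENNReal.ofReal_mul hT,
      ← ENNReal.ofReal_mul (by positivity), ENNReal.ofReal_le_ofReal_iff (by positivity)] at h1
    exact h1
  rcases (norm_nonneg y).eq_or_lt with h0 | h0
  · rw [← h0]; positivity
  refine abs_le_of_sq_le_sq' ?_ (by positivity) |>.2
  rw [mul_pow, Real.sq_sqrt hT]
  have : ‖y‖ ^ 2 * ‖y‖ ^ 2 ≤ (T * ‖F‖ ^ 2) * ‖y‖ ^ 2 := by linarith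
  exact le_of_mul_le_mul_right this (by positivity)

/-- `F ↦ ∫ₛᵗ F(r,·) dr` as a continuous linear map. -/
def intSliceL (s t : Icc (0 : ℝ) T) : Hts T d →L[ℝ] H T d :=
  (intSliceₗ s t).mkContinuous (√T) (norm_intSlice_le (s.2.1.trans s.2.2) s t)

theorem norm_intSliceL_le (s t : Icc (0 : ℝ) T) : ‖intSliceL (d := d) s t‖ ≤ √T :=
  LinearMap.mkContinuous_norm_le _ (Real.sqrt_nonneg _) _

end VolterraFlow

end

noncomputable section

namespace VolterraFlow

variable {T : ℝ} {d : ℕ}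

/-! ### Exponential weights. -/

section Weight

theorem memLp_exp_smul (c : ℝ) (w : H T d) :
    MemLp (fun ξ : Icc (0 : ℝ) T => Real.exp (c * ξ) • w ξ) 2 volume := by
  refine (Lp.memLp w).of_le_mul (c := Real.exp (|c| * T)) ?_ (Eventually.of_forall fun ξ => ?_)
  · have : Measurable fun ξ : Icc (0 : ℝ) T => Real.exp (c * ξ) := by fun_prop
    exact this.aestronglyMeasurable.smul (Lp.aestronglyMeasurable w)
  · rw [norm_smul, Real.norm_of_nonneg (Real.exp_nonneg _)]
    gcongr
    exacts [ξ.2.1, le_abs_self c, ξ.2.2]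

/-- Multiplication by `ξ ↦ exp (c ξ)` as a linear map. -/
def expMulₗ (T : ℝ) (d : ℕ) (c : ℝ) : H T d →ₗ[ℝ] H T d where
  toFun w := (memLp_exp_smul c w).toLp _
  map_add' w v := by
    rw [← MemLp.toLp_add]
    refine MemLp.toLp_congr _ _ ?_
    filter_upwards [Lp.coeFn_add w v] with ξ hξ
    rw [hξ, Pi.add_apply, Pi.add_apply, smul_add]
  map_smul' a w := by
    rw [RingHom.id_apply, ← MemLp.toLp_const_smul]
    refine MemLp.toLp_congr _ _ ?_
    filter_upwards [Lp.coeFn_smul a w] with ξ hξ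
    rw [hξ, Pi.smul_apply, Pi.smul_apply, smul_comm]

theorem coeFn_expMulₗ (c : ℝ) (w : H T d) :
    expMulₗ T d c w =ᵐ[volume] fun ξ : Icc (0 : ℝ) T => Real.exp (c * ξ) • w ξ :=
  (memLp_exp_smul c w).coeFn_toLp

/-- Both signs of `c` are needed: the inverse of multiplication by `exp(cξ)` is multiplication by
`exp(-cξ)`. -/
theorem norm_expMulₗ_le (c : ℝ) (w : H T d) :
    ‖expMulₗ T d c w‖ ≤ Real.exp (max (c * T) 0) * ‖w‖ := by
  refine Lp.norm_le_mul_norm_of_ae_le_mul ?_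
  filter_upwards [coeFn_expMulₗ c w] with ξ hξ
  rw [hξ, norm_smul, Real.norm_of_nonneg (Real.exp_nonneg _)]
  gcongr
  rcases le_total 0 c with hc | hc
  · exact le_max_of_le_left (mul_le_mul_of_nonneg_left ξ.2.2 hc)
  · exact le_max_of_le_right (mul_nonpos_of_nonpos_of_nonneg hc ξ.2.1)

theorem expMulₗ_expMulₗ_neg (c : ℝ) (w : H T d) : expMulₗ T d c (expMulₗ T d (-c) w) = w := by
  refine Lp.ext ?_
  filter_upwards [coeFn_expMulₗ c (expMulₗ T d (-c) w), coeFn_expMulₗ (-c) w] with ξ h1 h2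
  rw [h1, h2, smul_smul, ← Real.exp_add]
  simp

/-- Multiplication by `ξ ↦ exp (c ξ)` as an automorphism of `H`. -/
def expMul (T : ℝ) (d : ℕ) (c : ℝ) : H T d ≃L[ℝ] H T d :=
  ContinuousLinearEquiv.equivOfInverse ((expMulₗ T d c).mkContinuous _ (norm_expMulₗ_le c))
    ((expMulₗ T d (-c)).mkContinuous _ (norm_expMulₗ_le (-c)))
    (fun w => by simpa using expMulₗ_expMulₗ_neg (-c) w) (fun w => expMulₗ_expMulₗ_neg c w)

theorem coeFn_expMul (c : ℝ) (w : H T d) :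
    expMul T d c w =ᵐ[volume] fun ξ : Icc (0 : ℝ) T => Real.exp (c * ξ) • w ξ :=
  coeFn_expMulₗ c w

/-- With `norm_le_expMul_neg`, this makes the weighted norm equivalent to the `L²` norm, with
constants `1` and `exp(cT)`. -/
theorem norm_expMul_neg_le {c : ℝ} (hT : 0 ≤ T) (hc : 0 ≤ c) (w : H T d) :
    ‖expMul T d (-c) w‖ ≤ ‖w‖ := by
  have := norm_expMulₗ_le (-c) w
  rw [max_eq_right (by nlinarith), Real.exp_zero, one_mul] at this
  exact this

theorem norm_le_expMul_neg {c : ℝ} (hT : 0 ≤ T) (hc : 0 ≤ c) (w : H T d) :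
    ‖w‖ ≤ Real.exp (c * T) * ‖expMul T d (-c) w‖ := by
  have := norm_expMulₗ_le c (expMul T d (-c) w)
  rw [max_eq_left (by positivity)] at this
  have h2 : expMulₗ T d c (expMul T d (-c) w) = w := expMulₗ_expMulₗ_neg c w
  rwa [h2] at this

theorem enorm_expMul_sq (c : ℝ) (w : H T d) :
    ‖expMul T d c w‖ₑ ^ 2 =
      ∫⁻ ξ : Icc (0 : ℝ) T, ENNReal.ofReal (Real.exp (2 * c * ξ)) * ‖w ξ‖ₑ ^ 2 := by
  rw [enorm_sq_Lp_two]
  refine lintegral_congr_ae ?_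
  filter_upwards [coeFn_expMul c w] with ξ hξ
  rw [hξ, enorm_smul, mul_pow, Real.enorm_of_nonneg (Real.exp_nonneg _),
    ← ENNReal.ofReal_pow (Real.exp_nonneg _), ← Real.exp_nat_mul]
  norm_num [mul_assoc]

theorem inner_expMul_expMul (c : ℝ) (w : H T d) :
    (inner ℝ (expMul T d c (expMul T d c w)) w : ℝ) = ‖expMul T d c w‖ ^ 2 := by
  rw [← real_inner_self_eq_norm_sq, L2.inner_def, L2.inner_def]
  refine integral_congr_ae ?_
  filter_upwards [coeFn_expMul c w, coeFn_expMul c (expMul T d c w)] with ξ h1 h2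
  rw [h2, h1, real_inner_smul_left, real_inner_smul_right]

/-- Comparison of exponentially weighted integrals by comparison of distribution functions. -/
theorem lintegral_exp_neg_le {X Y : Type*} [MeasurableSpace X] [MeasurableSpace Y]
    {β : Measure X} {υ : Measure Y} {a : X → Icc (0 : ℝ) T} {b : Y → Icc (0 : ℝ) T}
    (ha : Measurable a) (hb : Measurable b) {c : ℝ} (hc : 0 < c)
    (h : ∀ t, β {x | a x < t} ≤ υ {y | b y ≤ t}) (huniv : β univ ≤ υ univ) :
    ∫⁻ x, ENNReal.ofReal (Real.exp (-c * a x)) ∂β ≤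
      ∫⁻ y, ENNReal.ofReal (Real.exp (-c * b y)) ∂υ := by
  -- Layer cake on both sides. The strict form on the left and the non-strict form on the right
  -- produce exactly the sets `a < t` and `b ≤ t` of the hypothesis.
  rw [lintegral_eq_lintegral_meas_lt β (Eventually.of_forall fun x => Real.exp_nonneg _)
      (by fun_prop),
    lintegral_eq_lintegral_meas_le υ (Eventually.of_forall fun x => Real.exp_nonneg _)
      (by fun_prop)]
  refine setLIntegral_mono' measurableSet_Ioi fun s (hs : 0 < s) => ?_
  have h1 : ∀ u : ℝ, s < Real.exp (-c * u) ↔ u < -Real.log s / c := fun u => by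
    rw [← Real.log_lt_iff_lt_exp hs, lt_div_iff₀ hc]
    constructor <;> intro h <;> linarith
  have h2 : ∀ u : ℝ, s ≤ Real.exp (-c * u) ↔ u ≤ -Real.log s / c := fun u => by
    rw [← Real.log_le_iff_le_exp hs, le_div_iff₀ hc]
    constructor <;> intro h <;> linarith
  simp only [h1, h2]
  -- The level may leave `[0,T]`: below `0` the left set is empty, above `T` the right set is
  -- everything and the total masses are compared.
  rcases lt_or_ge (-Real.log s / c) 0 with h0 | h0
  · have : {x | (a x : ℝ) < -Real.log s / c} = ∅ :=
      eq_empty_of_forall_notMem fun x hx => absurd (hx.trans h0) (not_lt.2 (a x).2.1)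
    simp [this]
  rcases le_or_gt (-Real.log s / c) T with h3 | h3
  · exact h ⟨_, h0, h3⟩
  · have : {y | (b y : ℝ) ≤ -Real.log s / c} = univ :=
      eq_univ_of_forall fun y => (b y).2.2.trans h3.le
    rw [this]
    exact (measure_mono (subset_univ _)).trans huniv

/-- Enlarging the domain to `(-∞, ξ]` gives exactly `1/c`. This is the source of smallness for large
`c`. -/
theorem lintegral_exp_convolution_le {c : ℝ} (hc : 0 < c) (ξ : Icc (0 : ℝ) T) :
    ∫⁻ r : Icc (0 : ℝ) T, (if r ≤ ξ then ENNReal.ofReal (Real.exp (c * (r - ξ))) else 0) ≤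
      ENNReal.ofReal (1 / c) := by
  calc ∫⁻ r : Icc (0 : ℝ) T, (if r ≤ ξ then ENNReal.ofReal (Real.exp (c * (r - ξ))) else 0)
      = ∫⁻ r : Icc (0 : ℝ) T, (Iic (ξ : ℝ)).indicator
          (fun r => ENNReal.ofReal (Real.exp (c * (r - ξ)))) r := by
        refine lintegral_congr fun r => ?_
        by_cases h : r ≤ ξ
        · have : (r : ℝ) ≤ ξ := h
          simp [h, this]
        · have : ¬ (r : ℝ) ≤ ξ := h
          simp [h, this]
    _ = ∫⁻ r in Icc (0 : ℝ) T, (Iic (ξ : ℝ)).indicator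
          (fun r => ENNReal.ofReal (Real.exp (c * (r - ξ)))) r :=
        lintegral_subtype_comap measurableSet_Icc _
    _ ≤ ∫⁻ r in Iic (ξ : ℝ), ENNReal.ofReal (Real.exp (c * (r - ξ))) := by
        rw [← lintegral_indicator measurableSet_Iic]
        exact setLIntegral_le_lintegral _ _
    _ = ENNReal.ofReal (1 / c) := by
        have h1 : ∀ r : ℝ, Real.exp (c * (r - ξ)) = Real.exp (-c * ξ) * Real.exp (c * r) :=
          fun r => by rw [← Real.exp_add]; ring_nf
        simp only [h1]
        rw [← ofReal_integral_eq_lintegral_ofReal ((integrableOn_exp_mul_Iic hc _).const_mul _)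
          (Eventually.of_forall fun r => by positivity), integral_const_mul,
          integral_exp_mul_Iic hc, ← mul_div_assoc, ← Real.exp_add]
        simp

end Weight

/-- The Volterra integral operator is small in exponentially weighted norms. -/
theorem enorm_expMul_intSlice_sq_le {c : ℝ} (hc : 0 < c) (s t : Icc (0 : ℝ) T) {F : Hts T d}
    (hF : ∀ᵐ z, z.2 < z.1 → F z = 0) :
    ‖expMul T d (-c) (intSlice s t F)‖ₑ ^ 2 ≤ ENNReal.ofReal (1 / (2 * c)) *
      ∫⁻ z, ENNReal.ofReal (Real.exp (-(2 * c) * z.1)) * ‖F z‖ₑ ^ 2 := by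
  set y := intSlice s t F
  set u := expMul T d (-c) y
  set A := ∫⁻ z, ENNReal.ofReal (Real.exp (-(2 * c) * z.1)) * ‖F z‖ₑ ^ 2
  let k : Icc (0 : ℝ) T × Icc (0 : ℝ) T → ℝ≥0∞ := fun z =>
    if z.1 ≤ z.2 then ENNReal.ofReal (Real.exp (c * (z.1 - z.2))) else 0
  have hk : Measurable k :=
    Measurable.ite (measurableSet_le measurable_fst measurable_snd) (by fun_prop) measurable_const
  have hu : Measurable fun z : Icc (0 : ℝ) T × Icc (0 : ℝ) T => ‖u z.2‖ₑ :=
    measurable_enorm_comp_snd u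
  have hFm := measurable_enorm_Hts F
  -- The pairing equals `‖u‖ ^ 2`. For `r ≤ ξ` (`z = (r, ξ)`) the weight splits as `exp(-cξ) =
  -- exp(-c(ξ-r)) exp(-cr)`; elsewhere `F` vanishes. The first factor goes with `u`, the second with
  -- `F`.
  have h1 : ‖(inner ℝ (expMul T d (-c) u) y : ℝ)‖ₑ ≤
      ∫⁻ z, (k z * ‖u z.2‖ₑ) * (ENNReal.ofReal (Real.exp (-c * z.1)) * ‖F z‖ₑ) := by
    refine (enorm_inner_intSlice_le s t F _).trans (lintegral_mono_ae ?_)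
    have h2 : ∀ᵐ z : Icc (0 : ℝ) T × Icc (0 : ℝ) T,
        (expMul T d (-c) u) z.2 = Real.exp (-c * z.2) • u z.2 :=
      Measure.quasiMeasurePreserving_snd.ae (coeFn_expMul (-c) u)
    filter_upwards [hF, h2] with z hz h2
    rcases lt_or_ge z.2 z.1 with h | h
    · simp [hz h]
    · simp only [k, h, if_true, h2, enorm_smul, Real.enorm_of_nonneg (Real.exp_nonneg _)]
      have h3 : Real.exp (-c * z.2) = Real.exp (c * (z.1 - z.2)) * Real.exp (-c * z.1) := by
        rw [← Real.exp_add]; ring_nf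
      rw [h3, ENNReal.ofReal_mul (Real.exp_nonneg _)]
      exact le_of_eq (by ring)
  -- Integrating first in `r` for fixed `ξ`: the squared kernel has rate `2c`, hence mass at most
  -- `1/(2c)`.
  have h2 : ∫⁻ z, (k z * ‖u z.2‖ₑ) ^ 2 ≤ ENNReal.ofReal (1 / (2 * c)) * ‖u‖ₑ ^ 2 := by
    have h3 := lintegral_prod_symm (μ := (volume : Measure (Icc (0 : ℝ) T))) (ν := volume)
      (fun z => (k z * ‖u z.2‖ₑ) ^ 2) ((hk.mul hu).pow_const 2).aemeasurable
    refine h3.le.trans ?_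
    rw [enorm_sq_Lp_two, ← lintegral_const_mul _ ((Lp.stronglyMeasurable u).enorm.pow_const 2)]
    refine lintegral_mono fun ξ => ?_
    simp only [mul_pow]
    have hk' : Measurable fun r => k (r, ξ) ^ 2 := (hk.comp measurable_prodMk_right).pow_const 2
    rw [lintegral_mul_const _ hk']
    gcongr
    refine le_trans (le_of_eq ?_) (lintegral_exp_convolution_le (by positivity : 0 < 2 * c) ξ)
    refine lintegral_congr fun r => ?_
    simp only [k]
    split_ifs
    · rw [← ENNReal.ofReal_pow (Real.exp_nonneg _), ← Real.exp_nat_mul]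
      norm_num [mul_assoc]
    · simp
  have h3 : ∫⁻ z, (ENNReal.ofReal (Real.exp (-c * z.1)) * ‖F z‖ₑ) ^ 2 = A := by
    refine lintegral_congr fun z => ?_
    rw [mul_pow, ← ENNReal.ofReal_pow (Real.exp_nonneg _), ← Real.exp_nat_mul]
    norm_num [mul_assoc]
  have h4 : (‖u‖ₑ ^ 2) ^ 2 ≤ ENNReal.ofReal (1 / (2 * c)) * ‖u‖ₑ ^ 2 * A := by
    have h5 : ‖(inner ℝ (expMul T d (-c) u) y : ℝ)‖ₑ = ‖u‖ₑ ^ 2 := by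
      rw [inner_expMul_expMul, enorm_pow, enorm_norm]
    rw [← h5, ← h3]
    refine (pow_le_pow_left' h1 2).trans ((lintegral_mul_sq_le (hk.mul hu).aemeasurable
      (by fun_prop)).trans ?_)
    rw [h5]
    gcongr
    exact h2
  rcases eq_or_ne (‖u‖ₑ) 0 with h0 | h0
  · simp [h0]
  have h5 : ‖u‖ₑ ^ 2 ≠ 0 := pow_ne_zero _ h0
  have h6 : ‖u‖ₑ ^ 2 ≠ ∞ := by finiteness
  have h7 : ‖u‖ₑ ^ 2 * ‖u‖ₑ ^ 2 ≤ ‖u‖ₑ ^ 2 * (ENNReal.ofReal (1 / (2 * c)) * A) := by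
    calc _ = (‖u‖ₑ ^ 2) ^ 2 := by ring
      _ ≤ _ := h4
      _ = _ := by ring
  exact (ENNReal.mul_le_mul_iff_right h5 h6).1 h7

end VolterraFlow

end

noncomputable section

namespace VolterraFlow

variable {T : ℝ} {d : ℕ} {C₀ γ : ℝ} {B : Lam2 T d → Hts T d}

/-! ### Causality of the drift and the weighted contraction. -/

section Causality

theorem enorm_sq_restrict {X F : Type*} [MeasurableSpace X] {μ : Measure X}
    [NormedAddCommGroup F] [NormedSpace ℝ F] (s : Set X) (f : Lp F 2 μ) :
    ‖LpToLpRestrictCLM X F ℝ μ 2 s f‖ₑ ^ 2 = ∫⁻ x in s, ‖f x‖ₑ ^ 2 ∂μ := by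
  rw [enorm_sq_Lp_two]
  refine lintegral_congr_ae ?_
  filter_upwards [LpToLpRestrictCLM_coeFn ℝ s f] with x hx
  rw [hx]

theorem norm_le_mul_iff_enorm_sq {F G : Type*} [NormedAddCommGroup F] [NormedAddCommGroup G]
    {C : ℝ} (hC : 0 ≤ C) (x : F) (y : G) :
    ‖x‖ ≤ C * ‖y‖ ↔ ‖x‖ₑ ^ 2 ≤ ENNReal.ofReal (C ^ 2) * ‖y‖ₑ ^ 2 := by
  rw [← ofReal_norm, ← ofReal_norm, ← ENNReal.ofReal_pow (norm_nonneg _),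
    ← ENNReal.ofReal_pow (norm_nonneg _), ← ENNReal.ofReal_mul (by positivity),
    ENNReal.ofReal_le_ofReal_iff (by positivity), ← mul_pow,
    pow_le_pow_iff_left₀ (norm_nonneg _) (by positivity) two_ne_zero]

theorem coeFn_toH (w : Lam2 T d) : toH T d w =ᵐ[volume] w :=
  ContinuousMap.coeFn_toLp (p := 2) (𝕜 := ℝ) volume (w : C(Icc (0 : ℝ) T, E d))

/-- A continuous cutoff function: `1` for `r ≤ t`, and `0` for `r ≥ t + 1/(n+1)`. -/
def cutoff (t : ℝ) (n : ℕ) (r : ℝ) : ℝ := max 0 (min 1 (1 - (n + 1) * (r - t)))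

theorem continuous_cutoff (t : ℝ) (n : ℕ) : Continuous (cutoff t n) := by
  unfold cutoff; fun_prop

theorem cutoff_of_le {t r : ℝ} (n : ℕ) (h : r ≤ t) : cutoff t n r = 1 := by
  have : (n + 1) * (r - t) ≤ 0 := mul_nonpos_of_nonneg_of_nonpos (by positivity) (by linarith)
  rw [cutoff, min_eq_left (by linarith), max_eq_right zero_le_one]

theorem cutoff_mem_Icc (t r : ℝ) (n : ℕ) : cutoff t n r ∈ Icc (0 : ℝ) 1 :=
  ⟨le_max_left _ _, max_le zero_le_one (min_le_left _ _)⟩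

theorem tendsto_cutoff_of_lt {t r : ℝ} (h : t < r) : Tendsto (cutoff t · r) atTop (𝓝 0) := by
  obtain ⟨N, hN⟩ := exists_nat_gt (1 / (r - t))
  refine tendsto_const_nhds.congr' ?_
  filter_upwards [eventually_ge_atTop N] with n hn
  have h1 : 1 < N * (r - t) := (div_lt_iff₀ (by linarith)).1 hN
  have h2 : (N : ℝ) * (r - t) ≤ (n + 1) * (r - t) := by
    have : (N : ℝ) ≤ n := by exact_mod_cast hn
    gcongr
    linarith
  rw [cutoff, max_eq_left]
  exact (min_le_right _ _).trans (by linarith)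

/-- The product of a continuous function with the cutoff function. -/
def cutoffMul (t : ℝ) (n : ℕ) (w : Lam2 T d) : Lam2 T d :=
  (⟨fun r => cutoff t n r • w r, by
    have h1 : Continuous fun r : Icc (0 : ℝ) T => cutoff t n r :=
      (continuous_cutoff t n).comp continuous_subtype_val
    exact h1.smul (ContinuousMap.continuous (w : C(Icc (0 : ℝ) T, E d)))⟩ :
      C(Icc (0 : ℝ) T, E d))

/-- Multiplying by an indicator would leave `Λ`, so the sharp truncation is reached from continuous
cutoffs by dominated convergence. -/
theorem tendsto_enorm_cutoffMul (t : Icc (0 : ℝ) T) (w : Lam2 T d) :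
    Tendsto (fun n => ‖toH T d (cutoffMul t n w)‖ₑ ^ 2) atTop
      (𝓝 (∫⁻ r in Iic t, ‖toH T d w r‖ₑ ^ 2)) := by
  have h1 : ∀ n, ‖toH T d (cutoffMul t n w)‖ₑ ^ 2 = ∫⁻ r : Icc (0 : ℝ) T, ‖cutoff t n r • toH T d w r‖ₑ ^ 2 := by
    intro n
    rw [enorm_sq_Lp_two]
    refine lintegral_congr_ae ?_
    filter_upwards [coeFn_toH (cutoffMul t n w), coeFn_toH w] with r h1 h2
    rw [h1, h2]
    rfl
  simp only [h1]
  rw [← lintegral_indicator measurableSet_Iic]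
  refine tendsto_lintegral_of_dominated_convergence (fun r => ‖toH T d w r‖ₑ ^ 2) (fun n => ?_)
    (fun n => Eventually.of_forall fun r => ?_) ?_ (Eventually.of_forall fun r => ?_)
  · have h1 : Continuous fun r : Icc (0 : ℝ) T => cutoff t n r :=
      (continuous_cutoff t n).comp continuous_subtype_val
    exact (h1.stronglyMeasurable.smul (Lp.stronglyMeasurable (toH T d w))).enorm.pow_const 2
  · have hc := cutoff_mem_Icc t r n
    have : ‖cutoff t n r • toH T d w r‖ₑ ≤ ‖toH T d w r‖ₑ := by
      rw [enorm_le_iff_norm_le, norm_smul, Real.norm_of_nonneg hc.1]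
      exact mul_le_of_le_one_left (norm_nonneg _) hc.2
    exact pow_le_pow_left' this 2
  · rw [← enorm_sq_Lp_two]; finiteness
  · rcases le_or_gt r t with h | h
    · have h' : (r : ℝ) ≤ t := h
      simp [cutoff_of_le _ h', h]
    · have h' : (t : ℝ) < r := h
      have h2 : r ∉ Iic t := not_le.2 h
      rw [indicator_of_notMem h2]
      have h3 : Tendsto (fun n => cutoff t n r • toH T d w r) atTop (𝓝 0) := by
        simpa using (tendsto_cutoff_of_lt h').smul_const (toH T d w r)
      have h4 := ((continuous_enorm (E := E d)).tendsto 0).comp h3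
      simpa [Function.comp_def] using (ENNReal.continuous_pow 2).tendsto _ |>.comp h4

theorem measurableSet_eq_Hts (F G : Hts T d) {p : Icc (0 : ℝ) T × Icc (0 : ℝ) T → Prop}
    (hp : MeasurableSet {z | p z}) : MeasurableSet {z | p z → F z = G z} := by
  have h1 : MeasurableSet {z | F z = G z} :=
    (Lp.stronglyMeasurable F).measurableSet_eq_fun (Lp.stronglyMeasurable G)
  have : {z | p z → F z = G z} = {z | p z}ᶜ ∪ {z | F z = G z} := by
    ext z; simp [imp_iff_not_or]
  rw [this]
  exact hp.compl.union h1

theorem DriftLipschitz.ae_eq_of_eqOn (hB : DriftLipschitz C₀ B) {w₁ w₂ : Lam2 T d}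
    {t : Icc (0 : ℝ) T} (h : ∀ r < t, w₁ r = w₂ r) :
    ∀ᵐ z : Icc (0 : ℝ) T × Icc (0 : ℝ) T, z.1 < t → B w₁ z = B w₂ z := by
  -- Nonanticipation is assumed for `t > 0` only; for `t = 0` no `z.1` lies before `t`.
  rcases t.2.1.eq_or_lt with h0 | h0
  · refine Eventually.of_forall fun z hz => absurd z.1.2.1 (not_le.2 ?_)
    have : (z.1 : ℝ) < t := hz
    linarith
  refine (Measure.ae_prod_iff_ae_ae (μ := (volume : Measure (Icc (0 : ℝ) T))) (ν := volume)
    (measurableSet_eq_Hts (B w₁) (B w₂) (measurableSet_lt measurable_fst measurable_const))).2 ?_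
  filter_upwards [hB.nonanticipative w₁ w₂ t h0 fun r _ hr => h r hr] with r hr
  rcases lt_or_ge r t with h1 | h1
  · filter_upwards [hr h1] with ξ hξ _ using hξ
  · exact Eventually.of_forall fun ξ h2 => absurd h2 (not_lt.2 h1)

/-- Before time `t`, `B w₂` may be replaced by `B v` for any `v` that agrees with `w₂` there.
Choosing `v` to rejoin `w₁` shortly after `t` makes `‖w₁ - v‖` tend to the norm of `w₁ - w₂` on
`[0,t]`, and the global Lipschitz bound applies to `w₁, v`. -/
theorem DriftLipschitz.lintegral_sub_le (hC₀ : 0 ≤ C₀) (hB : DriftLipschitz C₀ B)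
    (w₁ w₂ : Lam2 T d) (t : Icc (0 : ℝ) T) :
    ∫⁻ z in {z : Icc (0 : ℝ) T × Icc (0 : ℝ) T | z.1 < t}, ‖(B w₁ - B w₂) z‖ₑ ^ 2 ≤
      ENNReal.ofReal (C₀ ^ 2) * ∫⁻ r in Iic t, ‖toH T d (w₁ - w₂) r‖ₑ ^ 2 := by
  have hlim := ENNReal.Tendsto.const_mul (a := ENNReal.ofReal (C₀ ^ 2))
    (tendsto_enorm_cutoffMul t (w₁ - w₂)) (Or.inr ENNReal.ofReal_ne_top)
  refine ge_of_tendsto' hlim fun n => ?_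
  let v : Lam2 T d := w₁ - cutoffMul t n (w₁ - w₂)
  have hv : ∀ r < t, v r = w₂ r := by
    intro r hr
    have hr' : (r : ℝ) ≤ t := le_of_lt hr
    change w₁ r - cutoff t n r • (w₁ r - w₂ r) = w₂ r
    rw [cutoff_of_le n hr', one_smul, sub_sub_cancel]
  have h1 : ∫⁻ z in {z : Icc (0 : ℝ) T × Icc (0 : ℝ) T | z.1 < t}, ‖(B w₁ - B w₂) z‖ₑ ^ 2 =
      ∫⁻ z in {z : Icc (0 : ℝ) T × Icc (0 : ℝ) T | z.1 < t}, ‖(B w₁ - B v) z‖ₑ ^ 2 := by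
    refine setLIntegral_congr_fun_ae (measurableSet_lt measurable_fst measurable_const) ?_
    filter_upwards [hB.ae_eq_of_eqOn hv, Lp.coeFn_sub (B w₁) (B w₂),
      Lp.coeFn_sub (B w₁) (B v)] with z h1 h2 h3 hz
    rw [h2, h3, Pi.sub_apply, Pi.sub_apply, h1 hz]
  rw [h1]
  refine (setLIntegral_le_lintegral _ _).trans ?_
  rw [← enorm_sq_Lp_two, ← norm_le_mul_iff_enorm_sq hC₀]
  have h2 := hB.lipschitz w₁ v
  rwa [show w₁ - v = cutoffMul t n (w₁ - w₂) from sub_sub_cancel _ _, norm_Lam2] at h2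

/-- The extended drift is causal: before time `t` the increment of `B̄` is controlled by the
increment of the argument before time `t`. -/
theorem DriftLipschitz.lintegral_Bbar_sub_le (hC₀ : 0 ≤ C₀) (hB : DriftLipschitz C₀ B)
    (w₁ w₂ : H T d) (t : Icc (0 : ℝ) T) :
    ∫⁻ z in {z : Icc (0 : ℝ) T × Icc (0 : ℝ) T | z.1 < t}, ‖(Bbar B w₁ - Bbar B w₂) z‖ₑ ^ 2 ≤
      ENNReal.ofReal (C₀ ^ 2) * ∫⁻ r in Iic t, ‖(w₁ - w₂) r‖ₑ ^ 2 := by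
  have hc := hB.continuous_Bbar
  -- Restriction is a continuous operator, so in terms of norms the bound is a closed condition on
  -- `(w₁, w₂)` and need only be checked on `Λ`.
  rw [← enorm_sq_restrict, ← enorm_sq_restrict, ← norm_le_mul_iff_enorm_sq hC₀]
  refine isClosed_property2 (isDenseInducing_toH T d).dense (p := fun w₁ w₂ =>
    ‖LpToLpRestrictCLM _ (E d) ℝ volume 2 {z : Icc (0 : ℝ) T × Icc (0 : ℝ) T | z.1 < t}
      (Bbar B w₁ - Bbar B w₂)‖ ≤ C₀ * ‖LpToLpRestrictCLM _ (E d) ℝ volume 2 (Iic t) (w₁ - w₂)‖)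
    (isClosed_le (by fun_prop) (by fun_prop)) (fun a b => ?_) w₁ w₂
  rw [norm_le_mul_iff_enorm_sq hC₀, enorm_sq_restrict, enorm_sq_restrict, hB.Bbar_toH,
    hB.Bbar_toH, ← map_sub]
  exact hB.lintegral_sub_le hC₀ a b t

theorem ae_ne_top (T : ℝ) (t : Icc (0 : ℝ) T) : ∀ᵐ r : Icc (0 : ℝ) T, r ≠ t := by
  refine compl_mem_ae_iff.2 ?_
  have := (MeasurableEmbedding.subtype_coe (measurableSet_Icc (a := (0 : ℝ)) (b := T))).comap_apply
    volume {t}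
  refine this.trans ?_
  simp

theorem DriftLipschitz.volterra_ae (hT : 0 < T) (hB : DriftLipschitz C₀ B) (w : Lam2 T d) :
    ∀ᵐ z : Icc (0 : ℝ) T × Icc (0 : ℝ) T, z.2 < z.1 → B w z = 0 := by
  have h0 : MeasurableSet {z : Icc (0 : ℝ) T × Icc (0 : ℝ) T | z.2 < z.1 → B w z = 0} := by
    have h1 : MeasurableSet {z | B w z = 0} :=
      (Lp.stronglyMeasurable (B w)).measurableSet_eq_fun stronglyMeasurable_const
    have : {z : Icc (0 : ℝ) T × Icc (0 : ℝ) T | z.2 < z.1 → B w z = 0} =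
        {z | z.2 < z.1}ᶜ ∪ {z | B w z = 0} := by
      ext z; simp [imp_iff_not_or]
    rw [this]
    exact (measurableSet_lt measurable_snd measurable_fst).compl.union h1
  refine (Measure.ae_prod_iff_ae_ae (μ := (volume : Measure (Icc (0 : ℝ) T))) (ν := volume)
    h0).2 ?_
  -- Taking `t = T` covers all `r` except the null point `r = T`.
  filter_upwards [hB.volterra w ⟨T, hT.le, le_rfl⟩ hT, ae_ne_top T ⟨T, hT.le, le_rfl⟩] with r hr hr'
  exact hr (lt_of_le_of_ne r.2.2 hr')

theorem DriftLipschitz.volterra_Bbar (hT : 0 < T) (hB : DriftLipschitz C₀ B) (w : H T d) :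
    ∀ᵐ z : Icc (0 : ℝ) T × Icc (0 : ℝ) T, z.2 < z.1 → Bbar B w z = 0 := by
  have hc := hB.continuous_Bbar
  let R := LpToLpRestrictCLM _ (E d) ℝ volume 2 {z : Icc (0 : ℝ) T × Icc (0 : ℝ) T | z.2 < z.1}
  have hS : MeasurableSet {z : Icc (0 : ℝ) T × Icc (0 : ℝ) T | z.2 < z.1} :=
    measurableSet_lt measurable_snd measurable_fst
  have hR : ∀ F : Hts T d, R F = 0 ↔
      ∀ᵐ z : Icc (0 : ℝ) T × Icc (0 : ℝ) T, z.2 < z.1 → F z = 0 := by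
    intro F
    rw [Lp.eq_zero_iff_ae_eq_zero]
    have h1 := LpToLpRestrictCLM_coeFn (μ := volume) (p := 2) ℝ
      {z : Icc (0 : ℝ) T × Icc (0 : ℝ) T | z.2 < z.1} F
    refine Iff.trans ⟨fun h => h1.symm.trans h, fun h => h1.trans h⟩ ?_
    exact ae_restrict_iff' hS
  rw [← hR]
  refine (isDenseInducing_toH T d).dense.induction_on (p := fun w => R (Bbar B w) = 0) w
    (isClosed_eq (by fun_prop) continuous_const) fun a => ?_
  rw [hB.Bbar_toH, hR]
  exact hB.volterra_ae hT a

/-- Causality compares the measures with densities `‖F‖ ^ 2` and `C₀ ^ 2 ‖u‖ ^ 2` on every initial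
interval; `lintegral_exp_neg_le` turns this into a comparison of weighted integrals. -/
theorem DriftLipschitz.lintegral_exp_Bbar_sub_le (hC₀ : 0 ≤ C₀) (hB : DriftLipschitz C₀ B)
    {c : ℝ} (hc : 0 < c) (w₁ w₂ : H T d) :
    ∫⁻ z : Icc (0 : ℝ) T × Icc (0 : ℝ) T,
        ENNReal.ofReal (Real.exp (-(2 * c) * z.1)) * ‖(Bbar B w₁ - Bbar B w₂) z‖ₑ ^ 2 ≤
      ENNReal.ofReal (C₀ ^ 2) * ‖expMul T d (-c) (w₁ - w₂)‖ₑ ^ 2 := by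
  set F := Bbar B w₁ - Bbar B w₂
  set u := w₁ - w₂
  have hF : Measurable fun z => ‖F z‖ₑ ^ 2 := (measurable_enorm_Hts F).pow_const 2
  have hu : Measurable fun r => ENNReal.ofReal (C₀ ^ 2) * ‖u r‖ₑ ^ 2 :=
    ((Lp.stronglyMeasurable u).enorm.pow_const 2).const_mul _
  have hu' : Measurable fun r => ‖u r‖ₑ ^ 2 := (Lp.stronglyMeasurable u).enorm.pow_const 2
  have key := lintegral_exp_neg_le (T := T) (c := 2 * c)
    (β := (volume : Measure (Icc (0 : ℝ) T × Icc (0 : ℝ) T)).withDensity fun z => ‖F z‖ₑ ^ 2)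
    (υ := (volume : Measure (Icc (0 : ℝ) T)).withDensity fun r =>
      ENNReal.ofReal (C₀ ^ 2) * ‖u r‖ₑ ^ 2)
    (a := Prod.fst) (b := id) measurable_fst measurable_id (by positivity) (fun t => ?_) ?_
  · rw [lintegral_withDensity_eq_lintegral_mul _ hF (by fun_prop),
      lintegral_withDensity_eq_lintegral_mul _ hu (by fun_prop)] at key
    rw [enorm_expMul_sq, ← lintegral_const_mul _ (by fun_prop)]
    refine le_trans (le_of_eq ?_) (key.trans (le_of_eq ?_))
    · exact lintegral_congr fun z => mul_comm _ _
    · refine lintegral_congr fun r => ?_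
      simp only [Pi.mul_apply, id]
      rw [show 2 * -c = -(2 * c) by ring]
      ring
  · rw [withDensity_apply _ (measurableSet_lt measurable_fst measurable_const),
      withDensity_apply _ (measurableSet_le measurable_id measurable_const),
      lintegral_const_mul _ hu']
    exact hB.lintegral_Bbar_sub_le hC₀ w₁ w₂ t
  · rw [withDensity_apply _ MeasurableSet.univ, withDensity_apply _ MeasurableSet.univ,
      Measure.restrict_univ, Measure.restrict_univ, lintegral_const_mul _ hu',
      ← enorm_sq_Lp_two, ← enorm_sq_Lp_two, ← norm_le_mul_iff_enorm_sq hC₀]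
    exact hB.norm_Bbar_sub_le w₁ w₂

/-- The integrated drift is a contraction in an exponentially weighted norm. -/
theorem DriftLipschitz.norm_expMul_intSlice_sub_le (hT : 0 < T) (hC₀ : 0 < C₀)
    (hB : DriftLipschitz C₀ B) (s t : Icc (0 : ℝ) T) (w₁ w₂ : H T d) :
    ‖expMul T d (-(2 * C₀ ^ 2)) (intSlice s t (Bbar B w₁) - intSlice s t (Bbar B w₂))‖ ≤
      1 / 2 * ‖expMul T d (-(2 * C₀ ^ 2)) (w₁ - w₂)‖ := by
  have h0 : intSlice s t (Bbar B w₁) - intSlice s t (Bbar B w₂) =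
      intSlice s t (Bbar B w₁ - Bbar B w₂) := (map_sub (intSliceL s t) _ _).symm
  have hv : ∀ᵐ z : Icc (0 : ℝ) T × Icc (0 : ℝ) T, z.2 < z.1 → (Bbar B w₁ - Bbar B w₂) z = 0 := by
    filter_upwards [hB.volterra_Bbar hT w₁, hB.volterra_Bbar hT w₂,
      Lp.coeFn_sub (Bbar B w₁) (Bbar B w₂)] with z h1 h2 h3 hz
    rw [h3, Pi.sub_apply, h1 hz, h2 hz, sub_zero]
  rw [h0, norm_le_mul_iff_enorm_sq (by norm_num)]
  refine (enorm_expMul_intSlice_sq_le (by positivity) s t hv).trans ?_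
  refine (mul_le_mul_right (hB.lintegral_exp_Bbar_sub_le hC₀.le (by positivity) w₁ w₂) _).trans ?_
  -- With `c = 2C₀²` the squared factor `C₀² / (2c)` equals `1/4`, which explains the choice of
  -- weight.
  rw [← mul_assoc, ← ENNReal.ofReal_mul (by positivity)]
  refine le_of_eq ?_
  congr 2
  field_simp

end Causality

end VolterraFlow

end

noncomputable section

namespace VolterraFlow

/-! ### The equation `x = y + G x` in a Banach space. -/

section Resolvent

variable {X : Type*} [NormedAddCommGroup X] [NormedSpace ℝ X] {K : ℝ} {M : X ≃L[ℝ] X}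

/-- Stability of `x = y + G x` for `G` contracting in the norm `‖M ·‖`. -/
theorem norm_sub_le_of_contracting (hM : ∀ x, ‖M x‖ ≤ ‖x‖) (hK : ∀ x, ‖x‖ ≤ K * ‖M x‖)
    (hK0 : 0 ≤ K) {G : X → X} (hG : ∀ x y, ‖M (G x - G y)‖ ≤ 1 / 2 * ‖M (x - y)‖)
    {x₁ x₂ y₁ y₂ : X} (h₁ : x₁ = y₁ + G x₁) (h₂ : x₂ = y₂ + G x₂) :
    ‖x₁ - x₂‖ ≤ 2 * K * ‖y₁ - y₂‖ := by
  have h3 : x₁ - x₂ = (y₁ - y₂) + (G x₁ - G x₂) := by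
    nth_rewrite 1 [h₁, h₂]; abel
  have h4 : ‖M (x₁ - x₂)‖ ≤ ‖M (y₁ - y₂)‖ + ‖M (G x₁ - G x₂)‖ := by
    nth_rewrite 1 [h3]
    rw [map_add]
    exact norm_add_le _ _
  have h5 := hG x₁ x₂
  have h6 := hM (y₁ - y₂)
  have h7 := hK (x₁ - x₂)
  have h8 : ‖M (x₁ - x₂)‖ ≤ 2 * ‖y₁ - y₂‖ := by linarith
  calc ‖x₁ - x₂‖ ≤ K * ‖M (x₁ - x₂)‖ := h7
    _ ≤ K * (2 * ‖y₁ - y₂‖) := by gcongr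
    _ = _ := by ring

/-- Conjugation by `M` gives a contraction in the original norm, to which Banach's fixed point
theorem applies. -/
theorem exists_eq_add_of_contracting [CompleteSpace X] {G : X → X}
    (hG : ∀ x y, ‖M (G x - G y)‖ ≤ 1 / 2 * ‖M (x - y)‖) (y : X) : ∃ x, x = y + G x := by
  have hc : ContractingWith (1 / 2) fun u => M (y + G (M.symm u)) := by
    refine ⟨by norm_num, LipschitzWith.of_dist_le_mul fun u v => ?_⟩
    rw [dist_eq_norm, dist_eq_norm, ← map_sub, add_sub_add_left_eq_sub]
    simpa [← map_sub] using hG (M.symm u) (M.symm v)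
  refine ⟨M.symm (hc.fixedPoint _), ?_⟩
  have h := hc.fixedPoint_isFixedPt
  rw [Function.IsFixedPt] at h
  have h2 := congrArg M.symm h
  rw [M.symm_apply_apply] at h2
  exact h2.symm

/-- The derivative of a `1/2`-Lipschitz map has norm at most `1/2`; this is applied to the conjugate
of `G` by `M`. Thus the linearized equation falls under the same two lemmas as the nonlinear one. -/
theorem norm_fderiv_apply_le_of_contracting {G : X → X}
    (hG : ∀ x y, ‖M (G x - G y)‖ ≤ 1 / 2 * ‖M (x - y)‖) {D : X →L[ℝ] X} {x : X}
    (hD : HasFDerivAt G D x) (v : X) : ‖M (D v)‖ ≤ 1 / 2 * ‖M v‖ := by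
  have h1 : HasFDerivAt (fun u => M (G (M.symm u)))
      ((M : X →L[ℝ] X) ∘L D ∘L (M.symm : X →L[ℝ] X)) (M x) := by
    refine (M : X →L[ℝ] X).hasFDerivAt.comp _ (HasFDerivAt.comp _ ?_ (M.symm : X →L[ℝ] X).hasFDerivAt)
    simpa using hD
  have h2 : LipschitzWith (1 / 2) fun u => M (G (M.symm u)) := by
    refine LipschitzWith.of_dist_le_mul fun u v => ?_
    rw [dist_eq_norm, dist_eq_norm, ← map_sub]
    simpa [← map_sub] using hG (M.symm u) (M.symm v)
  have h3 := h1.le_of_lipschitz h2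
  have h4 := ContinuousLinearMap.le_of_opNorm_le _ h3 (M v)
  simpa using h4

/-- The solution map of `x = y + G x`, for a differentiable `G` that contracts in the norm
`‖M ·‖`, and its derivative, which is the solution map of the linearized equation. -/
theorem exists_solutionMap [CompleteSpace X] (hM : ∀ x, ‖M x‖ ≤ ‖x‖)
    (hK : ∀ x, ‖x‖ ≤ K * ‖M x‖) (hK0 : 0 ≤ K) {G : X → X} {D : X → X →L[ℝ] X}
    (hG : ∀ x y, ‖M (G x - G y)‖ ≤ 1 / 2 * ‖M (x - y)‖) (hD : ∀ x, HasFDerivAt G (D x) x) :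
    ∃ (S : X → X) (L : X → X →L[ℝ] X),
      (∀ y x, x = y + G x ↔ x = S y) ∧ (∀ y, HasFDerivAt S (L y) y) ∧
      (∀ y η v, v = η + D (S y) v ↔ v = L y η) ∧
      (∀ y₁ y₂, ‖S y₁ - S y₂‖ ≤ 2 * K * ‖y₁ - y₂‖) ∧ (∀ y, ‖L y‖ ≤ 2 * K) ∧
      ∀ y₁ y₂, ‖L y₁ - L y₂‖ ≤ 2 * K * ‖D (S y₁) - D (S y₂)‖ * (2 * K) := by
  choose S hS using exists_eq_add_of_contracting hG
  have hSu : ∀ y x, x = y + G x ↔ x = S y := by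
    refine fun y x => ⟨fun h => ?_, fun h => h ▸ hS y⟩
    have := norm_sub_le_of_contracting hM hK hK0 hG h (hS y)
    rw [sub_self, norm_zero, mul_zero] at this
    exact sub_eq_zero.1 (norm_le_zero_iff.1 this)
  have hSl : ∀ y₁ y₂, ‖S y₁ - S y₂‖ ≤ 2 * K * ‖y₁ - y₂‖ := fun y₁ y₂ =>
    norm_sub_le_of_contracting hM hK hK0 hG (hS y₁) (hS y₂)
  have hDc : ∀ x u v, ‖M (D x u - D x v)‖ ≤ 1 / 2 * ‖M (u - v)‖ := fun x u v => by
    rw [← map_sub (D x)]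
    exact norm_fderiv_apply_le_of_contracting hG (hD x) _
  have hker : ∀ x v, v = D x v → v = 0 := fun x v h => by
    have := norm_sub_le_of_contracting (y₁ := 0) (y₂ := 0) hM hK hK0 (hDc x)
      (by simpa using h) (x₂ := 0) (by simp)
    simpa using this
  -- Uniqueness for the linearized equation gives injectivity of `id - D x`, existence gives
  -- surjectivity, and the open mapping theorem a bounded inverse.
  have hequiv : ∀ x, ∃ e : X ≃L[ℝ] X, ∀ v, e v = v - D x v := fun x => by
    let A : X →L[ℝ] X := ContinuousLinearMap.id ℝ X - D x
    have hA : ∀ v, A v = v - D x v := fun v => rfl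
    have h1 : A.ker = ⊥ := by
      refine LinearMap.ker_eq_bot'.2 fun v hv => hker x v (sub_eq_zero.1 ?_)
      exact hv
    have h2 : A.range = ⊤ := by
      refine LinearMap.range_eq_top.2 fun y => ?_
      obtain ⟨v, hv⟩ := exists_eq_add_of_contracting (hDc x) y
      exact ⟨v, (sub_eq_iff_eq_add.2 hv : v - D x v = y)⟩
    exact ⟨ContinuousLinearEquiv.ofBijective A h1 h2, fun v => rfl⟩
  choose e he using hequiv
  have hLu : ∀ x η v, v = η + D x v ↔ v = (e x).symm η := fun x η v => by
    rw [← sub_eq_iff_eq_add, ← he, ContinuousLinearEquiv.eq_symm_apply]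
  have hLe : ∀ x η, (e x).symm η = η + D x ((e x).symm η) := fun x η => (hLu x η _).2 rfl
  have hLn : ∀ x η, ‖(e x).symm η‖ ≤ 2 * K * ‖η‖ := fun x η => by
    have := norm_sub_le_of_contracting (y₁ := η) (y₂ := 0) hM hK hK0 (hDc x)
      (hLe x η) (x₂ := 0) (by simp)
    simpa using this
  refine ⟨S, fun y => (e (S y)).symm, hSu, fun y => ?_, fun y => hLu (S y), hSl,
    fun y => ContinuousLinearMap.opNorm_le_bound _ (by positivity) (hLn (S y)), fun y₁ y₂ => ?_⟩
  · have hcont : ContinuousAt S y := by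
      have : LipschitzWith (2 * K).toNNReal S := LipschitzWith.of_dist_le_mul fun u v => by
        rw [dist_eq_norm, dist_eq_norm, Real.coe_toNNReal _ (by positivity)]
        exact hSl u v
      exact this.continuous.continuousAt
    have hF : HasFDerivAt (fun x => x - G x) (e (S y) : X →L[ℝ] X) (S y) := by
      have h1 : (e (S y) : X →L[ℝ] X) = ContinuousLinearMap.id ℝ X - D (S y) :=
        ContinuousLinearMap.ext (he (S y))
      rw [h1]
      exact (hasFDerivAt_id (S y)).sub (hD (S y))
    -- `S` is a continuous right inverse of `id - G`, whose derivative at `S y` is invertible.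
    -- Continuity of `D` is not needed, as `S` is already at hand.
    refine HasFDerivAt.of_local_left_inverse hcont hF (Eventually.of_forall fun z => ?_)
    exact sub_eq_iff_eq_add.2 (hS z)
  · refine ContinuousLinearMap.opNorm_le_bound _ (by positivity) fun η => ?_
    set v₁ := (e (S y₁)).symm η
    set v₂ := (e (S y₂)).symm η
    -- Resolvent identity `L₁ - L₂ = L₁ (D₁ - D₂) L₂`; each outer factor contributes `2K`.
    have h1 : v₁ - v₂ = (e (S y₁)).symm ((D (S y₁) - D (S y₂)) v₂) := by
      rw [← hLu, sub_apply, map_sub]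
      have h2 : v₁ = η + D (S y₁) v₁ := hLe _ η
      have h3 : v₂ = η + D (S y₂) v₂ := hLe _ η
      nth_rewrite 1 [h2, h3]
      abel
    change ‖v₁ - v₂‖ ≤ _
    rw [h1]
    calc _ ≤ 2 * K * (‖D (S y₁) - D (S y₂)‖ * (2 * K * ‖η‖)) := by
          refine (hLn _ _).trans ?_
          gcongr
          exact (ContinuousLinearMap.le_opNorm _ _).trans (by gcongr; exact hLn _ η)
      _ = _ := by ring

end Resolvent

/-! ### From the deterministic solution map to `L²(Ω;X)`. -/

section RandomShift

variable {Ω : Type*} [MeasurableSpace Ω] {P : Measure Ω} [IsProbabilityMeasure P]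
  {X : Type*} [NormedAddCommGroup X] {K C γ : ℝ} {S : X → X}

/-- `S(φ + I) - S(φ)` is dominated by `K‖I‖`, and the constant `S(φ)` is square integrable because
`P` is finite. -/
theorem memLp_comp_add (hS : Continuous S) (hSl : ∀ x y, ‖S x - S y‖ ≤ K * ‖x - y‖)
    (I : Lp X 2 P) (φ : X) : MemLp (fun ω => S (φ + I ω)) 2 P := by
  have hI : AEStronglyMeasurable (fun ω => φ + I ω) P :=
    aestronglyMeasurable_const.add (Lp.aestronglyMeasurable I)
  have h1 : MemLp (fun ω => S (φ + I ω) - S φ) 2 P := by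
    refine (Lp.memLp I).of_le_mul (c := K)
      ((hS.comp_aestronglyMeasurable hI).sub aestronglyMeasurable_const)
      (Eventually.of_forall fun ω => ?_)
    simpa using hSl (φ + I ω) φ
  have h2 := h1.add (memLp_const (S φ))
  refine h2.ae_eq (Eventually.of_forall fun ω => ?_)
  simp

theorem norm_Lp_le_of_ae_bound {f : Lp X 2 P} {c : ℝ} (hc : 0 ≤ c)
    (h : ∀ᵐ ω ∂P, ‖f ω‖ ≤ c) : ‖f‖ ≤ c := by
  have h1 : measureUnivNNReal P = 1 := by simp [measureUnivNNReal]
  simpa [h1] using Lp.norm_le_of_ae_bound hc h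

variable [NormedSpace ℝ X] {L : X → X →L[ℝ] X}

theorem memLp_clm_comp_add (hL : Continuous L) (hLn : ∀ y, ‖L y‖ ≤ K) (I : Lp X 2 P) (φ η : X) :
    MemLp (fun ω => L (φ + I ω) η) 2 P := by
  have hI : AEStronglyMeasurable (fun ω => φ + I ω) P :=
    aestronglyMeasurable_const.add (Lp.aestronglyMeasurable I)
  have h1 : Continuous fun y => L y η := hL.clm_apply continuous_const
  refine MemLp.of_bound (h1.comp_aestronglyMeasurable hI) (K * ‖η‖)
    (Eventually.of_forall fun ω => ContinuousLinearMap.le_of_opNorm_le _ (hLn _) η)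

/-- The map `η ↦ L(φ + I)η` from `X` to `L²(Ω;X)`. -/
def randomShiftCLM (hL : Continuous L) (hLn : ∀ y, ‖L y‖ ≤ K) (I : Lp X 2 P) (φ : X) :
    X →L[ℝ] Lp X 2 P :=
  LinearMap.mkContinuous
    { toFun := fun η => (memLp_clm_comp_add hL hLn I φ η).toLp _
      map_add' := fun η ζ => by
        rw [← MemLp.toLp_add]
        exact MemLp.toLp_congr _ _ (Eventually.of_forall fun ω => map_add _ _ _)
      map_smul' := fun c η => by
        rw [RingHom.id_apply, ← MemLp.toLp_const_smul]
        exact MemLp.toLp_congr _ _ (Eventually.of_forall fun ω => map_smul _ _ _) } K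
    fun η => by
      refine norm_Lp_le_of_ae_bound
        (mul_nonneg ((norm_nonneg _).trans (hLn 0)) (norm_nonneg _)) ?_
      filter_upwards [(memLp_clm_comp_add hL hLn I φ η).coeFn_toLp] with ω hω
      exact hω ▸ ContinuousLinearMap.le_of_opNorm_le _ (hLn _) η

theorem coeFn_randomShiftCLM (hL : Continuous L) (hLn : ∀ y, ‖L y‖ ≤ K) (I : Lp X 2 P)
    (φ η : X) : randomShiftCLM hL hLn I φ η =ᵐ[P] fun ω => L (φ + I ω) η :=
  (memLp_clm_comp_add hL hLn I φ η).coeFn_toLp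

/-- `φ ↦ S(φ + I)` is differentiable as a map into `L²(Ω;X)` if `S` has a Hölder derivative. -/
theorem hasFDerivAt_randomShift (hC : 0 ≤ C) (hγ : 0 < γ) (hS : ∀ y, HasFDerivAt S (L y) y)
    (hSl : ∀ x y, ‖S x - S y‖ ≤ K * ‖x - y‖) (hLn : ∀ y, ‖L y‖ ≤ K)
    (hLγ : ∀ x y, ‖L x - L y‖ ≤ C * ‖x - y‖ ^ γ) (hL : Continuous L) (hSc : Continuous S)
    (I : Lp X 2 P) (φ : X) :
    HasFDerivAt (fun φ => (memLp_comp_add hSc hSl I φ).toLp _) (randomShiftCLM hL hLn I φ) φ := by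
  -- The increment `u` does not depend on `ω`, so the pathwise remainder bound is uniform in `ω` and
  -- bounds the `L²` norm with the same constant.
  refine hasFDerivAt_of_taylor_le (C := C) hγ fun u => norm_Lp_le_of_ae_bound (by positivity) ?_
  filter_upwards [(memLp_comp_add hSc hSl I (φ + u)).coeFn_toLp,
    (memLp_comp_add hSc hSl I φ).coeFn_toLp, coeFn_randomShiftCLM hL hLn I φ u,
    Lp.coeFn_sub ((memLp_comp_add hSc hSl I (φ + u)).toLp _ -
      (memLp_comp_add hSc hSl I φ).toLp _) (randomShiftCLM hL hLn I φ u),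
    Lp.coeFn_sub ((memLp_comp_add hSc hSl I (φ + u)).toLp _)
      ((memLp_comp_add hSc hSl I φ).toLp _)] with ω h1 h2 h3 h4 h5
  rw [h4, Pi.sub_apply, h5, Pi.sub_apply, h1, h2, h3, add_right_comm]
  exact norm_taylor_le_of_holder hC hγ hS hLγ _ u

theorem norm_randomShiftCLM_sub_le (hC : 0 ≤ C) (hLn : ∀ y, ‖L y‖ ≤ K)
    (hLγ : ∀ x y, ‖L x - L y‖ ≤ C * ‖x - y‖ ^ γ) (hL : Continuous L) (I : Lp X 2 P) (φ ψ : X) :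
    ‖randomShiftCLM hL hLn I φ - randomShiftCLM hL hLn I ψ‖ ≤ C * ‖φ - ψ‖ ^ γ := by
  refine ContinuousLinearMap.opNorm_le_bound _ (by positivity) fun η =>
    norm_Lp_le_of_ae_bound (by positivity) ?_
  filter_upwards [coeFn_randomShiftCLM hL hLn I φ η, coeFn_randomShiftCLM hL hLn I ψ η,
    Lp.coeFn_sub (randomShiftCLM hL hLn I φ η) (randomShiftCLM hL hLn I ψ η)] with ω h1 h2 h3
  rw [sub_apply, h3, Pi.sub_apply, h1, h2, ← sub_apply]
  refine ContinuousLinearMap.le_of_opNorm_le _ ?_ η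
  simpa using hLγ (φ + I ω) (ψ + I ω)

end RandomShift

end VolterraFlow

end

/-! ### Assembly. -/

open VolterraFlow in
theorem mainTheorem3 (d : ℕ) (T : ℝ) (hT : 0 < T) (C₀ : ℝ) (hC₀ : 0 < C₀) :
    ∃ C₂ : ℝ, 0 < C₂ ∧
      ∀ (Ω : Type*) [mΩ : MeasurableSpace Ω] (P : Measure Ω) [IsProbabilityMeasure P]
        (𝓕 : Filtration (Icc (0 : ℝ) T) mΩ) (_ : UsualConditions 𝓕 P)
        (W : Icc (0 : ℝ) T → Ω → VolterraFlow.E d) (_ : IsBrownianMotion 𝓕 P W)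
        (α : ℝ) (hα : 1 / 2 < α) (_ : α < 1)
        (γ : ℝ) (_ : 0 < γ) (_ : γ ≤ 1)
        (B : Lam2 T d → Hts T d) (_ : DriftC1 C₀ γ B)
        (s t : Icc (0 : ℝ) T) (_ : s ≤ t),
        Differentiable ℝ (Bbar B) ∧
        (∀ φ : H T d, ∃! w : Lp (H T d) 2 P, IsSolution P W hα B s t φ w) ∧
        ∀ w : H T d → Lp (H T d) 2 P, (∀ φ, IsSolution P W hα B s t φ (w φ)) →
          IsC1Holder γ w ∧
          (∀ φ ψ : H T d,
            IsLinearizedSolution P B s t (w φ) ψ (fderiv ℝ w φ ψ) ∧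
            ∀ v, IsLinearizedSolution P B s t (w φ) ψ v → v = fderiv ℝ w φ ψ) ∧
          (∀ φ ψ η : H T d, ∀ᵐ ω ∂P,
            ‖fderiv ℝ w φ η ω‖ ≤ C₂ * ‖η‖ ∧
            ‖fderiv ℝ w φ η ω - fderiv ℝ w ψ η ω‖ ≤ C₂ * ‖w φ ω - w ψ ω‖ ^ γ * ‖η‖) := by
  set K := Real.exp (2 * C₀ ^ 2 * T) with hKdef
  have hK0 : 0 < K := Real.exp_pos _
  -- `2K` bounds `L`; the other summand is the constant of `hLS`, where `√T` bounds the integration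
  -- operator and `C₀` is the Hölder constant of `DB̄`.
  refine ⟨2 * K + 2 * K * (√T * C₀) * (2 * K), by positivity, ?_⟩
  intro Ω mΩ P _ 𝓕 _ W _ α hα _ γ hγ _ B hB s t _
  have hBL := hB.toDriftLipschitz
  obtain ⟨D, hD, hDγ⟩ := hB.exists_hasFDerivAt_Bbar hT hC₀.le hγ
  have hfd : ∀ w, fderiv ℝ (Bbar B) w = D w := fun w => (hD w).fderiv
  obtain ⟨S, L, hSu, hS, hLu, hSl, hLn, hLd⟩ := exists_solutionMap
    (M := expMul T d (-(2 * C₀ ^ 2))) (K := K) (norm_expMul_neg_le hT.le (by positivity))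
    (norm_le_expMul_neg hT.le (by positivity)) hK0.le
    (G := fun w => intSlice s t (Bbar B w)) (D := fun w => intSliceL s t ∘L D w)
    (hBL.norm_expMul_intSlice_sub_le hT hC₀ s t)
    (fun w => (intSliceL s t).hasFDerivAt.comp w (hD w))
  have hLS : ∀ y₁ y₂, ‖L y₁ - L y₂‖ ≤ 2 * K * (√T * C₀) * (2 * K) * ‖S y₁ - S y₂‖ ^ γ := by
    intro y₁ y₂
    have h1 : ‖intSliceL s t ∘L D (S y₁) - intSliceL s t ∘L D (S y₂)‖ ≤
        √T * (C₀ * ‖S y₁ - S y₂‖ ^ γ) := by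
      rw [← ContinuousLinearMap.comp_sub]
      refine (ContinuousLinearMap.opNorm_comp_le _ _).trans ?_
      gcongr
      exacts [norm_intSliceL_le s t, hDγ _ _]
    calc _ ≤ _ := hLd y₁ y₂
      _ ≤ 2 * K * (√T * (C₀ * ‖S y₁ - S y₂‖ ^ γ)) * (2 * K) := by gcongr
      _ = _ := by ring
  -- Measuring increments by `y` instead of `S y` costs the `γ`-dependent factor `(2K)^γ`. The
  -- pathwise estimate uses `hLS` directly, which keeps `C₂` independent of `γ`.
  set C := 2 * K * (√T * C₀) * (2 * K) * (2 * K) ^ γ with hCdef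
  have hC : 0 ≤ C := by positivity
  have hLγ : ∀ y₁ y₂, ‖L y₁ - L y₂‖ ≤ C * ‖y₁ - y₂‖ ^ γ := by
    intro y₁ y₂
    calc _ ≤ _ := hLS y₁ y₂
      _ ≤ 2 * K * (√T * C₀) * (2 * K) * (2 * K * ‖y₁ - y₂‖) ^ γ := by gcongr; exact hSl y₁ y₂
      _ = _ := by rw [Real.mul_rpow (by positivity) (norm_nonneg _), hCdef]; ring
  have hLc : Continuous L := (uniformContinuous_of_holder hγ hLγ).continuous
  have hSc : Continuous S := continuous_iff_continuousAt.2 fun y => (hS y).continuousAt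
  set I := stochIntegral P W (sigma hα) s t
  have hsol : ∀ φ (v : Lp (H T d) 2 P), IsSolution P W hα B s t φ v ↔
      v = (memLp_comp_add hSc hSl I φ).toLp _ := by
    intro φ v
    -- For fixed `ω` this is the deterministic equation with datum `y = φ + I(ω)`, so existence and
    -- uniqueness hold pathwise.
    have h1 : IsSolution P W hα B s t φ v ↔ v =ᵐ[P] fun ω => S (φ + I ω) := by
      refine eventually_congr (Eventually.of_forall fun ω => ?_)
      rw [← hSu, add_right_comm]
    rw [h1]
    have h2 := (memLp_comp_add hSc hSl I φ).coeFn_toLp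
    exact ⟨fun h => Lp.ext (h.trans h2.symm), fun h => h ▸ h2⟩
  refine ⟨fun w => (hD w).differentiableAt, fun φ => ⟨_, (hsol φ _).2 rfl, fun v => (hsol φ v).1⟩,
    fun w hw => ?_⟩
  -- By uniqueness any family of solutions is the explicit one, whose derivative is known.
  obtain rfl : w = fun φ => (memLp_comp_add hSc hSl I φ).toLp _ :=
    funext fun φ => (hsol φ _).1 (hw φ)
  have hder := hasFDerivAt_randomShift hC hγ hS hSl hLn hLγ hLc hSc I
  have hfw : fderiv ℝ (fun φ => (memLp_comp_add hSc hSl I φ).toLp _) =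
      randomShiftCLM hLc hLn I := funext fun φ => (hder φ).fderiv
  have hhol := norm_randomShiftCLM_sub_le hC hLn hLγ hLc I
  refine ⟨⟨contDiff_one_iff_fderiv.2 ⟨fun φ => (hder φ).differentiableAt, ?_⟩, C, ?_⟩, ?_, ?_⟩
  · rw [hfw]
    exact (uniformContinuous_of_holder hγ hhol).continuous
  · rw [hfw]
    exact hhol
  · intro φ ψ
    rw [hfw]
    have h1 : ∀ v : Lp (H T d) 2 P, IsLinearizedSolution P B s t
        ((memLp_comp_add hSc hSl I φ).toLp _) ψ v ↔ v =ᵐ[P] fun ω => L (φ + I ω) ψ := by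
      intro v
      refine eventually_congr ?_
      filter_upwards [(memLp_comp_add hSc hSl I φ).coeFn_toLp] with ω hω
      rw [hω, ← hLu, hfd]
      rfl
    have h2 := coeFn_randomShiftCLM hLc hLn I φ ψ
    exact ⟨(h1 _).2 h2, fun v hv => Lp.ext (((h1 v).1 hv).trans h2.symm)⟩
  · intro φ ψ η
    rw [hfw]
    filter_upwards [coeFn_randomShiftCLM hLc hLn I φ η, coeFn_randomShiftCLM hLc hLn I ψ η,
      (memLp_comp_add hSc hSl I φ).coeFn_toLp, (memLp_comp_add hSc hSl I ψ).coeFn_toLp]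
      with ω h1 h2 h3 h4
    rw [h1, h2, h3, h4]
    constructor
    · refine (ContinuousLinearMap.le_of_opNorm_le _ (hLn _) η).trans ?_
      gcongr
      exact le_add_of_nonneg_right (by positivity)
    · rw [← sub_apply]
      refine (ContinuousLinearMap.le_of_opNorm_le _ (hLS _ _) η).trans ?_
      gcongr
      exact le_add_of_nonneg_left (by positivity)
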